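/- **Setting.** Let $m,n\ge 1$ be integers, let $\mathcal H$ be a complex Hilbert space and let $\mathbb F_n^+$ be the unital free semigroup on generators $g_1,\dots,g_n$, with unit $g_0$; $|\alpha|$ is the length and $\tilde\alpha$ the reverse of a word $\alpha$. For an $n$-tuple $X=(X_1,\dots,X_n)$ of operators and $\alpha=g_{i_1}\cdots g_{i_k}$ put $X_\alpha:=X_{i_1}\cdots X_{i_k}$, $X_{g_0}:=I$. Let $f=\sum_{\alpha}a_\alpha X_\alpha$ be a positive regular free holomorphic function: $a_\alpha\ge 0$, $a_{g_0}=0$, $a_{g_i}>0$ for $i=1,\dots,n$, and for some $\rho>0$ the series $\sum_{k}\sum_{|\alpha|=k}a_\alpha X_\alpha$ converges in norm for all $X\in B(\mathcal H)^n$ with $\|\sum_i X_iX_i^*\|<\rho$. Put $b_{g_0}:=1$ and $$b_\alpha:=\sum_{j=1}^{|\alpha|}\ \sum_{\gamma_1\cdots\gamma_j=\alpha,\ |\gamma_i|\ge1}a_{\gamma_1}\cdots a_{\gamma_j}\binom{j+m-1}{m-1}\qquad(|\alpha|\ge 1).$$ On the full Fock space $F^2(H_n)$ with orthonormal basis $(e_\alpha)_{\alpha\in\mathbb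 F_n^+}$ and vacuum vector $1=e_{g_0}$, let $W_i$ and $\Lambda_i$ be the bounded operators with $$W_ie_\alpha=\sqrt{b_\alpha/b_{g_i\alpha}}\;e_{g_i\alpha},\qquad \Lambda_ie_\alpha=\sqrt{b_\alpha/b_{\alpha g_i}}\;e_{\alpha g_i}.$$ Let $\mathcal S:=\overline{\mathrm{span}}\{W_\alpha W_\beta^*:\alpha,\beta\in\mathbb F_n^+\}$ (norm closure), and let $\mathcal A_n(\mathbf D_f^m)\subset\mathcal S$ be the norm closed algebra generated by $W_1,\dots,W_n$ and the identity. For $T\in B(\mathcal H)^n$ put $\Phi_{f,T}(Y):=\sum_{|\alpha|\ge1}a_\alpha T_\alpha YT_\alpha^*$ (weak operator topology). The noncommutative domain $\mathbf D_f^m(\mathcal H)$ is the set of all $T\in B(\mathcal H)^n$ for which the series $\Phi_{f,T}(I)$ converges and $(\mathrm{id}-\Phi_{f,T})^k(I)\ge 0$ for $1\le k\le m$; for such $T$ put $\Delta_T:=[(\mathrm{id}-\Phi_{f,T})^m(I)]^{1/2}$. $T\in\mathbf D_f^m(\mathcal H)$ has the *radial property* if there is $\delta\in(0,1)$ with $rT\in\mathbf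 D_f^m(\mathcal H)$ for all $r\in(\delta,1)$; it is *pure* if $\Phi_{f,T}^k(I)\to0$ strongly as $k\to\infty$. For $T\in\mathbf D_f^m(\mathcal H)$ with $r_f(T):=\lim_k\|\Phi_{f,T}^k(I)\|^{1/2k}<1$, the Berezin transform $\mathbf B_T:B(F^2(H_n))\to B(\mathcal H)$ is given by $$\langle\mathbf B_T[g]x,y\rangle:=\Big\langle\Big(I-\sum_{|\alpha|\ge1}a_{\tilde\alpha}\Lambda_\alpha^*\otimes T_{\tilde\alpha}\Big)^{-m}(g\otimes\Delta_T^2)\Big(I-\sum_{|\alpha|\ge1}a_{\tilde\alpha}\Lambda_\alpha\otimes T_{\tilde\alpha}^*\Big)^{-m}(1\otimes x),\,1\otimes y\Big\rangle .$$ For $T\in\mathbf D_f^m(\mathcal H)$ the extended Berezin transform is $\widetilde{\mathbf B}_T[g]:=K_T^*(g\otimes I_{\mathcal H})K_T$, where $K_T:\mathcal H\to F^2(H_n)\otimes\mathcal H$, $K_Th:=\sum_\alpha\sqrt{b_\alpha}\,e_\alpha\otimes\Delta_TT_\alpha^*h$. **Theorem.** Let $T\in\mathbf D_f^m(\mathcal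 H)$ have the radial property. Then for all $r<1$ sufficiently close to $1$ the transform $\mathbf B_{rT}$ is defined (that is, $rT\in\mathbf D_f^m(\mathcal H)$, $r_f(rT)<1$, and the series converge and the inverses exist), and there is a unital completely contractive linear map $\Psi:\mathcal S\to B(\mathcal H)$ such that $$\Psi(g)=\lim_{r\to1^-}\mathbf B_{rT}[g],\qquad g\in\mathcal S,$$ in the norm topology of $B(\mathcal H)$, and $\Psi(W_\alpha W_\beta^*)=T_\alpha T_\beta^*$ for all $\alpha,\beta\in\mathbb F_n^+$. In particular, the restriction of $\Psi$ to $\mathcal A_n(\mathbf D_f^m)$ is a completely contractive (unital algebra) homomorphism. If, in addition, $T$ is pure, then the series defining $K_T$ converges and $\lim_{r\to1^-}\mathbf B_{rT}[g]=\widetilde{\mathbf B}_T[g]$ in norm for every $g\in\mathcal S$. -/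

import Mathlib

open Filter Topology
open scoped TensorProduct

noncomputable section

namespace NCDomain

/-! ### Words, monomials and positive regular free power series -/

/-- The monomial `X_α = X_{i_1} ⋯ X_{i_k}` for the word `α = g_{i_1} ⋯ g_{i_k}` of the free semigroup
on `n` generators. Words are lists of letters, the product of words is concatenation, the unit
is `[]`, and the reverse of `α` is `α.reverse`. -/
def mono {n : ℕ} {A : Type*} [Monoid A] (X : Fin n → A) (α : List (Fin n)) : A :=
  (α.map X).prod

/-- Coefficients of a positive regular formal power series `f = ∑ a_α X_α` in `n` noncommuting
variables: `a_α ≥ 0`, the constant term is `0`, and `a_{g_i} > 0` for every generator. -/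
structure PosRegular (n : ℕ) where
  coeff : List (Fin n) → ℝ
  coeff_nonneg : ∀ α, 0 ≤ coeff α
  coeff_nil : coeff [] = 0
  coeff_letter : ∀ i, 0 < coeff [i]

/-- `f` is a free holomorphic function on the ball `{X : ‖∑ X_i X_i^*‖ < ρ}` of `B(H)^n`:
the series `∑_k ∑_{|α|=k} a_α X_α` converges in norm at every point of the ball. -/
def PosRegular.IsFreeHolomorphicOn {n : ℕ} (f : PosRegular n) (H : Type*) [NormedAddCommGroup H]
    [InnerProductSpace ℂ H] [CompleteSpace H] (ρ : ℝ) : Prop :=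
  ∀ X : Fin n → H →L[ℂ] H, ‖∑ i, X i * star (X i)‖ < ρ →
    ∃ L : H →L[ℂ] H, Tendsto (fun N : ℕ => ∑ k ∈ Finset.range N, ∑ s : Fin k → Fin n,
      (f.coeff (List.ofFn s) : ℂ) • mono X (List.ofFn s)) atTop (𝓝 L)

/-- The coefficient
`b_α^{(m)} = ∑_j ∑_{γ_1 ⋯ γ_j = α, |γ_i| ≥ 1} a_{γ_1} ⋯ a_{γ_j} * C(j + m - 1, m - 1)`.
The factorizations of `α` into nonempty words correspond to the compositions of `|α|`;
for the empty word the only one is the empty factorization, so that the value is `1`. -/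
def PosRegular.b {n : ℕ} (f : PosRegular n) (m : ℕ) (α : List (Fin n)) : ℝ :=
  ∑ c : Composition α.length,
    ((α.splitWrtComposition c).map f.coeff).prod * ((c.length + m - 1).choose (m - 1) : ℝ)

section Weights

variable {n : ℕ} (f : PosRegular n) (m : ℕ)

theorem PosRegular.term_nonneg (α : List (Fin n)) (c : Composition α.length) :
    0 ≤ ((α.splitWrtComposition c).map f.coeff).prod *
      ((c.length + m - 1).choose (m - 1) : ℝ) := by
  refine mul_nonneg (List.prod_nonneg ?_) (Nat.cast_nonneg _)
  intro x hx
  obtain ⟨γ, -, rfl⟩ := List.mem_map.1 hx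
  exact f.coeff_nonneg γ

theorem PosRegular.b_nonneg (α : List (Fin n)) : 0 ≤ f.b m α :=
  Finset.sum_nonneg fun c _ => f.term_nonneg m α c

theorem PosRegular.b_cons_ge (i : Fin n) (α : List (Fin n)) :
    f.coeff [i] * f.b m α ≤ f.b m (i :: α) := by
  let e : Composition α.length → Composition (i :: α).length := fun c =>
    ⟨1 :: c.blocks, by
      intro k hk
      rcases List.mem_cons.1 hk with rfl | hk
      · exact one_pos
      · exact c.blocks_pos hk, by simp [c.blocks_sum, add_comm]⟩
  have he : Function.Injective e := by
    intro c d h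
    have h1 := congrArg Composition.blocks h
    exact Composition.ext (List.cons.inj h1).2
  unfold PosRegular.b
  rw [Finset.mul_sum]
  calc _ ≤ ∑ c : Composition α.length, (((i :: α).splitWrtComposition (e c)).map f.coeff).prod *
          (((e c).length + m - 1).choose (m - 1) : ℝ) := by
        refine Finset.sum_le_sum fun c _ => ?_
        have h1 : (i :: α).splitWrtComposition (e c) = [i] :: α.splitWrtComposition c := by
          simp [e, List.splitWrtComposition, List.splitWrtCompositionAux_cons]
        have h2 : (e c).length = c.length + 1 := by simp [e, Composition.length]
        rw [h1, h2, List.map_cons, List.prod_cons, ← mul_assoc]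
        refine mul_le_mul_of_nonneg_left ?_ (mul_nonneg (f.coeff_nonneg _) (List.prod_nonneg ?_))
        · exact_mod_cast Nat.choose_le_choose _ (by omega)
        · intro x hx
          obtain ⟨γ, -, rfl⟩ := List.mem_map.1 hx
          exact f.coeff_nonneg γ
    _ = ∑ d ∈ Finset.univ.map ⟨e, he⟩, (((i :: α).splitWrtComposition d).map f.coeff).prod *
          ((d.length + m - 1).choose (m - 1) : ℝ) := by
        rw [Finset.sum_map]; rfl
    _ ≤ _ := Finset.sum_le_sum_of_subset_of_nonneg (Finset.subset_univ _)
        fun d _ _ => f.term_nonneg m _ d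

theorem splitAux_snoc (i : Fin n) : ∀ (ns : List ℕ) (α : List (Fin n)), ns.sum = α.length →
    (α ++ [i]).splitWrtCompositionAux (ns ++ [1]) = α.splitWrtCompositionAux ns ++ [[i]]
  | [], α, h => by
    have : α = [] := List.length_eq_zero_iff.1 (by simpa using h.symm)
    subst this
    simp [List.splitWrtCompositionAux]
  | k :: ns, α, h => by
    have hk : k ≤ α.length := by simp at h; omega
    have h2 : ns.sum = (α.drop k).length := by simp at h ⊢; omega
    rw [List.cons_append, List.splitWrtCompositionAux_cons, List.splitWrtCompositionAux_cons,
      List.take_append_of_le_length hk, List.drop_append_of_le_length hk,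
      splitAux_snoc i ns _ h2, List.cons_append]

theorem PosRegular.b_snoc_ge (i : Fin n) (α : List (Fin n)) :
    f.coeff [i] * f.b m α ≤ f.b m (α ++ [i]) := by
  let e : Composition α.length → Composition (α ++ [i]).length := fun c =>
    ⟨c.blocks ++ [1], by
      intro k hk
      rcases List.mem_append.1 hk with hk | hk
      · exact c.blocks_pos hk
      · rw [List.mem_singleton.1 hk]; exact one_pos, by simp [c.blocks_sum]⟩
  have he : Function.Injective e := by
    intro c d h
    have h1 := congrArg Composition.blocks h
    exact Composition.ext (List.append_cancel_right h1)
  unfold PosRegular.b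
  rw [Finset.mul_sum]
  calc _ ≤ ∑ c : Composition α.length, (((α ++ [i]).splitWrtComposition (e c)).map f.coeff).prod *
          (((e c).length + m - 1).choose (m - 1) : ℝ) := by
        refine Finset.sum_le_sum fun c _ => ?_
        have h1 : (α ++ [i]).splitWrtComposition (e c) = α.splitWrtComposition c ++ [[i]] :=
          splitAux_snoc i c.blocks α c.blocks_sum
        have h2 : (e c).length = c.length + 1 := by simp [e, Composition.length]
        rw [h1, h2, List.map_append, List.prod_append, List.map_singleton, List.prod_singleton,
          ← mul_assoc, mul_comm (f.coeff [i])]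
        refine mul_le_mul_of_nonneg_left ?_ (mul_nonneg (List.prod_nonneg ?_) (f.coeff_nonneg _))
        · exact_mod_cast Nat.choose_le_choose _ (by omega)
        · intro x hx
          obtain ⟨γ, -, rfl⟩ := List.mem_map.1 hx
          exact f.coeff_nonneg γ
    _ = ∑ d ∈ Finset.univ.map ⟨e, he⟩, (((α ++ [i]).splitWrtComposition d).map f.coeff).prod *
          ((d.length + m - 1).choose (m - 1) : ℝ) := by
        rw [Finset.sum_map]; rfl
    _ ≤ _ := Finset.sum_le_sum_of_subset_of_nonneg (Finset.subset_univ _)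
        fun d _ _ => f.term_nonneg m _ d

theorem sqrt_ratio_le {a x y : ℝ} (ha : 0 < a) (hx : 0 ≤ x) (h : a * x ≤ y) :
    |√(x / y)| ≤ 1 / √a := by
  rw [abs_of_nonneg (Real.sqrt_nonneg _), one_div, ← Real.sqrt_inv]
  refine Real.sqrt_le_sqrt ?_
  rcases (mul_nonneg ha.le hx).trans h |>.eq_or_lt with hy | hy
  · rw [← hy, div_zero]; exact (inv_pos.2 ha).le
  · rw [div_le_iff₀ hy, inv_mul_eq_div, le_div_iff₀ ha]; linarith

end Weights

/-! ### The full Fock space and the weighted creation operators -/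

/-- The full Fock space `F²(H_n)` on `n` generators, as `ℓ²` of the set of words: the basis vector
`e_α = e_{i_1} ⊗ ⋯ ⊗ e_{i_k}` of `H_n^{⊗ k}` is indexed by the word `α = g_{i_1} ⋯ g_{i_k}`. -/
abbrev Fock (n : ℕ) : Type := lp (fun _ : List (Fin n) => ℂ) 2

/-- The canonical orthonormal basis vector `e_α`; `e_[]` is the vacuum vector `1`. -/
def e {n : ℕ} (α : List (Fin n)) : Fock n := lp.single 2 α (1 : ℂ)

section Creation

variable {n : ℕ}

theorem orthonormal_e : Orthonormal ℂ (e : List (Fin n) → Fock n) := by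
  rw [orthonormal_iff_ite]
  intro α β
  rw [e, e, lp.inner_single_left, lp.single_apply, Pi.single_apply]
  split_ifs <;> simp

/-- The isometry `e_α ↦ e_{σ α}` for an injective map `σ` of the set of words. -/
def permIsometry (σ : List (Fin n) → List (Fin n)) (hσ : Function.Injective σ) :
    Fock n →L[ℂ] Fock n :=
  ((orthonormal_e.comp σ hσ).orthogonalFamily.linearIsometry).toContinuousLinearMap

/-- The diagonal operator `e_α ↦ w_α e_α` for a bounded family of real weights `w`. -/
def diagOp (w : List (Fin n) → ℝ) (C : ℝ) (hC : ∀ α, |w α| ≤ C) : Fock n →L[ℂ] Fock n :=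
  have hle : ∀ (x : Fock n) (α : List (Fin n)), ‖(w α : ℂ) * x α‖ ≤ ‖((C : ℂ) • x) α‖ := by
    intro x α
    have h0 : 0 ≤ C := (abs_nonneg _).trans (hC α)
    rw [lp.coeFn_smul, Pi.smul_apply, norm_smul, norm_mul]
    refine mul_le_mul_of_nonneg_right ?_ (norm_nonneg _)
    simpa [abs_of_nonneg h0] using hC α
  LinearMap.mkContinuous
    { toFun := fun x => ⟨fun α => (w α : ℂ) * x α, (lp.memℓp ((C : ℂ) • x)).mono' (hle x)⟩
      map_add' := fun x y => by ext α; exact mul_add _ _ _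
      map_smul' := fun c x => by ext α; simp; ring }
    C (fun x => by
      have h0 : 0 ≤ C := (abs_nonneg _).trans (hC [])
      refine (lp.norm_mono (p := 2) (y := (C : ℂ) • x) (by norm_num) (hle x)).trans ?_
      rw [norm_smul]
      simp [abs_of_nonneg h0])

theorem permIsometry_e (σ : List (Fin n) → List (Fin n)) (hσ : Function.Injective σ)
    (α : List (Fin n)) : permIsometry σ hσ (e α) = e (σ α) := by
  simp [permIsometry, e, OrthogonalFamily.linearIsometry_apply_single]

theorem diagOp_e (w : List (Fin n) → ℝ) (C : ℝ) (hC : ∀ α, |w α| ≤ C) (α : List (Fin n)) :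
    diagOp w C hC (e α) = (w α : ℂ) • e α := by
  ext β
  rw [lp.coeFn_smul, Pi.smul_apply, smul_eq_mul]
  change (w β : ℂ) * e α β = (w α : ℂ) * e α β
  by_cases h : β = α
  · rw [h]
  · simp [e, lp.single_apply, h]

variable (f : PosRegular n) (m : ℕ)

/-- The weighted left creation operators `W_i = S_i D_i`, that is
`W_i e_α = √(b_α / b_{g_i α}) e_{g_i α}`. -/
def W (i : Fin n) : Fock n →L[ℂ] Fock n :=
  permIsometry (fun α => i :: α) (List.cons_injective) *
    diagOp (fun α => √(f.b m α / f.b m (i :: α))) (1 / √(f.coeff [i]))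
      (fun α => sqrt_ratio_le (f.coeff_letter i) (f.b_nonneg m α) (f.b_cons_ge m i α))

/-- The weighted right creation operators `Λ_i = R_i G_i`, that is
`Λ_i e_α = √(b_α / b_{α g_i}) e_{α g_i}`. -/
def Lam (i : Fin n) : Fock n →L[ℂ] Fock n :=
  permIsometry (fun α => α ++ [i]) (List.append_left_injective [i]) *
    diagOp (fun α => √(f.b m α / f.b m (α ++ [i]))) (1 / √(f.coeff [i]))
      (fun α => sqrt_ratio_le (f.coeff_letter i) (f.b_nonneg m α) (f.b_snoc_ge m i α))

theorem W_e (i : Fin n) (α : List (Fin n)) :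
    W f m i (e α) = (√(f.b m α / f.b m (i :: α)) : ℂ) • e (i :: α) := by
  rw [W, mul_apply_eq_comp, diagOp_e, map_smul, permIsometry_e]

theorem Lam_e (i : Fin n) (α : List (Fin n)) :
    Lam f m i (e α) = (√(f.b m α / f.b m (α ++ [i])) : ℂ) • e (α ++ [i]) := by
  rw [Lam, mul_apply_eq_comp, diagOp_e, map_smul, permIsometry_e]

/-- The operator system `S`, the norm closed span of the operators `W_α W_β^*`. -/
def opSystem : Submodule ℂ (Fock n →L[ℂ] Fock n) :=
  (Submodule.span ℂ (Set.range fun p : List (Fin n) × List (Fin n) =>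
    mono (W f m) p.1 * star (mono (W f m) p.2))).topologicalClosure

/-- The domain algebra: the norm closure of the polynomials in `W_1, …, W_n` and the identity. -/
def domainAlgebra : Subalgebra ℂ (Fock n →L[ℂ] Fock n) :=
  (Algebra.adjoin ℂ (Set.range (W f m))).topologicalClosure

theorem mono_mem_opSystem (α β : List (Fin n)) :
    mono (W f m) α * star (mono (W f m) β) ∈ opSystem f m :=
  Submodule.le_topologicalClosure _ (Submodule.subset_span ⟨(α, β), rfl⟩)

theorem one_mem_opSystem : (1 : Fock n →L[ℂ] Fock n) ∈ opSystem f m := by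
  simpa [mono] using mono_mem_opSystem f m [] []

theorem domainAlgebra_le_opSystem :
    Subalgebra.toSubmodule (domainAlgebra f m) ≤ opSystem f m := by
  have h : Subalgebra.toSubmodule (Algebra.adjoin ℂ (Set.range (W f m))) ≤
      Submodule.span ℂ (Set.range fun p : List (Fin n) × List (Fin n) =>
        mono (W f m) p.1 * star (mono (W f m) p.2)) := by
    rw [Algebra.adjoin_eq_span]
    refine Submodule.span_mono ?_
    intro x hx
    obtain ⟨l, hl, rfl⟩ := Submonoid.exists_list_of_mem_closure hx
    have : ∃ α : List (Fin n), α.map (W f m) = l := by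
      clear hx
      induction l with
      | nil => exact ⟨[], rfl⟩
      | cons y l ih =>
        obtain ⟨α, hα⟩ := ih fun z hz => hl z (List.mem_cons_of_mem _ hz)
        obtain ⟨i, hi⟩ := hl y List.mem_cons_self
        exact ⟨i :: α, by simp [hα, hi]⟩
    obtain ⟨α, rfl⟩ := this
    exact ⟨(α, []), by simp [mono]⟩
  exact closure_mono h

end Creation

/-! ### Hilbert tensor products and sums in the weak operator topology -/

/-- The Hilbert space tensor product: the completion of the algebraic tensor product. -/
abbrev HTensor (E F : Type*) [NormedAddCommGroup E] [InnerProductSpace ℂ E]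
    [NormedAddCommGroup F] [InnerProductSpace ℂ F] : Type _ :=
  UniformSpace.Completion (E ⊗[ℂ] F)

/-- The operator `A ⊗ B` on the Hilbert tensor product. -/
def tensorOp {E F : Type*} [NormedAddCommGroup E] [InnerProductSpace ℂ E]
    [NormedAddCommGroup F] [InnerProductSpace ℂ F] (A : E →L[ℂ] E) (B : F →L[ℂ] F) :
    HTensor E F →L[ℂ] HTensor E F :=
  (TensorProduct.mapL A B).completion

/-- The operator `y ↦ x ⊗ y`. -/
def tensorVec {E : Type*} (F : Type*) [NormedAddCommGroup E] [InnerProductSpace ℂ E]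
    [NormedAddCommGroup F] [InnerProductSpace ℂ F] (x : E) : F →L[ℂ] HTensor E F :=
  UniformSpace.Completion.toComplL ∘L TensorProduct.mkL ℂ E F x

/-- Convergence of `∑ u_i` in the weak operator topology. -/
def WOTSummable {ι E F : Type*} [NormedAddCommGroup E] [InnerProductSpace ℂ E]
    [NormedAddCommGroup F] [InnerProductSpace ℂ F] (u : ι → E →L[ℂ] F) : Prop :=
  Summable fun i => ContinuousLinearMapWOT.ofCLM (u i)

/-- The sum of `∑ u_i` in the weak operator topology. -/
def wotSum {ι E F : Type*} [NormedAddCommGroup E] [InnerProductSpace ℂ E]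
    [NormedAddCommGroup F] [InnerProductSpace ℂ F] (u : ι → E →L[ℂ] F) : E →L[ℂ] F :=
  (∑' i, ContinuousLinearMapWOT.ofCLM (u i)).toCLM

/-! ### Noncommutative domains and Berezin transforms -/

section Domain

variable {n : ℕ} {H : Type*} [NormedAddCommGroup H] [InnerProductSpace ℂ H] [CompleteSpace H]

/-- `Φ_{f,T}(Y) = ∑_{|α| ≥ 1} a_α T_α Y T_α^*` (the term of the empty word vanishes). -/
def Phi (f : PosRegular n) (T : Fin n → H →L[ℂ] H) (Y : H →L[ℂ] H) : H →L[ℂ] H :=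
  wotSum fun α => (f.coeff α : ℂ) • (mono T α * Y * star (mono T α))

/-- `(id - Φ_{f,T})^k (I)`. -/
def defect (f : PosRegular n) (T : Fin n → H →L[ℂ] H) (k : ℕ) : H →L[ℂ] H :=
  (fun Y => Y - Phi f T Y)^[k] 1

/-- The noncommutative domain `D_f^m(H)`: the series defining `Φ_{f,T}(I)` converges and
`(id - Φ_{f,T})^k (I) ≥ 0` for `1 ≤ k ≤ m`. -/
def domain (f : PosRegular n) (m : ℕ) (H : Type*) [NormedAddCommGroup H] [InnerProductSpace ℂ H]
    [CompleteSpace H] : Set (Fin n → H →L[ℂ] H) :=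
  {T | WOTSummable (fun α => (f.coeff α : ℂ) • (mono T α * star (mono T α))) ∧
    ∀ k, 1 ≤ k → k ≤ m → 0 ≤ defect f T k}

/-- The tuple `rT = (rT_1, …, rT_n)`. -/
def scale (r : ℝ) (T : Fin n → H →L[ℂ] H) : Fin n → H →L[ℂ] H := fun i => (r : ℂ) • T i

/-- The radial property: `T ∈ D_f^m(H)` and `rT ∈ D_f^m(H)` for all `r` in some `(δ, 1)`. -/
def HasRadialProperty (f : PosRegular n) (m : ℕ) (T : Fin n → H →L[ℂ] H) : Prop :=
  T ∈ domain f m H ∧ ∃ δ : ℝ, 0 < δ ∧ δ < 1 ∧ ∀ r : ℝ, δ < r → r < 1 → scale r T ∈ domain f m H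

/-- `T` is pure: `Φ_{f,T}^k(I) → 0` in the strong operator topology. -/
def IsPure (f : PosRegular n) (T : Fin n → H →L[ℂ] H) : Prop :=
  ∀ x : H, Tendsto (fun k : ℕ => ((Phi f T)^[k] 1) x) atTop (𝓝 0)

/-- The joint spectral radius `r_f(T) = lim_k ‖Φ_{f,T}^k(I)‖^{1/2k}` exists and equals `s`. -/
def HasJointSpectralRadius (f : PosRegular n) (T : Fin n → H →L[ℂ] H) (s : ℝ) : Prop :=
  Tendsto (fun k : ℕ => ‖(Phi f T)^[k] 1‖ ^ (1 / (2 * (k : ℝ)))) atTop (𝓝 s)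

/-- The defect operator `Δ_{f,m,T} = [(id - Φ_{f,T})^m (I)]^{1/2}`. -/
def Delta (f : PosRegular n) (m : ℕ) (T : Fin n → H →L[ℂ] H) : H →L[ℂ] H :=
  CFC.sqrt (defect f T m)

/-- The terms `a_{α~} Λ_α ⊗ T_{α~}^*`, where `α~` is the reverse of `α`. -/
def resTerm (f : PosRegular n) (m : ℕ) (T : Fin n → H →L[ℂ] H) (α : List (Fin n)) :
    HTensor (Fock n) H →L[ℂ] HTensor (Fock n) H :=
  (f.coeff α.reverse : ℂ) • tensorOp (mono (Lam f m) α) (star (mono T α.reverse))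

/-- The terms `a_{α~} Λ_α^* ⊗ T_{α~}`. -/
def resTermStar (f : PosRegular n) (m : ℕ) (T : Fin n → H →L[ℂ] H) (α : List (Fin n)) :
    HTensor (Fock n) H →L[ℂ] HTensor (Fock n) H :=
  (f.coeff α.reverse : ℂ) • tensorOp (star (mono (Lam f m) α)) (mono T α.reverse)

/-- The data entering the definition of the Berezin transform at `T` make sense:
`T ∈ D_f^m(H)`, `r_f(T) < 1`, the two series over `|α| ≥ 1` converge and the operators
`I - ∑ a_{α~} Λ_α^* ⊗ T_{α~}` and `I - ∑ a_{α~} Λ_α ⊗ T_{α~}^*` are invertible. -/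
structure BerezinDefined (f : PosRegular n) (m : ℕ) (T : Fin n → H →L[ℂ] H) : Prop where
  mem_domain : T ∈ domain f m H
  radius_lt_one : ∃ s < 1, HasJointSpectralRadius f T s
  summable : WOTSummable (resTerm f m T)
  summable_star : WOTSummable (resTermStar f m T)
  isUnit : IsUnit (1 - wotSum (resTerm f m T))
  isUnit_star : IsUnit (1 - wotSum (resTermStar f m T))

/-- The noncommutative Berezin transform `B_T`, given by
`⟨B_T[g] x, y⟩ = ⟨(I - ∑ a_{α~} Λ_α^* ⊗ T_{α~})^{-m} (g ⊗ Δ²)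
  (I - ∑ a_{α~} Λ_α ⊗ T_{α~}^*)^{-m} (1 ⊗ x), 1 ⊗ y⟩`. -/
def berezin (f : PosRegular n) (m : ℕ) (T : Fin n → H →L[ℂ] H) (g : Fock n →L[ℂ] Fock n) :
    H →L[ℂ] H :=
  (tensorVec H (e [] : Fock n)).adjoint ∘L
    (Ring.inverse (1 - wotSum (resTermStar f m T)) ^ m * tensorOp g (Delta f m T ^ 2) *
      Ring.inverse (1 - wotSum (resTerm f m T)) ^ m) ∘L tensorVec H (e [] : Fock n)

/-- The terms `h ↦ √b_α e_α ⊗ Δ T_α^* h` of the Berezin kernel. -/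
def kernelTerm (f : PosRegular n) (m : ℕ) (T : Fin n → H →L[ℂ] H) (α : List (Fin n)) :
    H →L[ℂ] HTensor (Fock n) H :=
  (√(f.b m α) : ℂ) • (tensorVec H (e α) ∘L Delta f m T ∘L star (mono T α))

/-- The noncommutative Berezin kernel `K_{f,T}^{(m)} h = ∑_α √b_α e_α ⊗ Δ T_α^* h`. -/
def kernel (f : PosRegular n) (m : ℕ) (T : Fin n → H →L[ℂ] H) : H →L[ℂ] HTensor (Fock n) H :=
  wotSum (kernelTerm f m T)

/-- The extended noncommutative Berezin transform `K^* (g ⊗ I) K`. -/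
def extBerezin (f : PosRegular n) (m : ℕ) (T : Fin n → H →L[ℂ] H) (g : Fock n →L[ℂ] Fock n) :
    H →L[ℂ] H :=
  (kernel f m T).adjoint ∘L tensorOp g 1 ∘L kernel f m T

end Domain

/-! ### Completely contractive maps -/

/-- The operator on the Hilbert space direct sum `E^{(k)}` given by a `k × k` operator matrix. -/
def opMatrix {E : Type*} [NormedAddCommGroup E] [InnerProductSpace ℂ E] {k : ℕ}
    (x : Matrix (Fin k) (Fin k) (E →L[ℂ] E)) :
    PiLp 2 (fun _ : Fin k => E) →L[ℂ] PiLp 2 (fun _ : Fin k => E) :=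
  (PiLp.continuousLinearEquiv 2 ℂ (fun _ : Fin k => E)).symm.toContinuousLinearMap ∘L
    ContinuousLinearMap.pi fun i => ∑ j, x i j ∘L PiLp.proj 2 (fun _ : Fin k => E) j

/-- A linear map `u` from a space `X` of operators on `E` to the operators on `F` is completely
contractive: `‖[u(x_{ij})]‖ ≤ ‖[x_{ij}]‖` for all square matrices over `X`. -/
def CompletelyContractive {E F : Type*} [NormedAddCommGroup E] [InnerProductSpace ℂ E]
    [NormedAddCommGroup F] [InnerProductSpace ℂ F] {X : Submodule ℂ (E →L[ℂ] E)}
    (u : X →ₗ[ℂ] (F →L[ℂ] F)) : Prop :=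
  ∀ (k : ℕ) (x : Matrix (Fin k) (Fin k) X),
    ‖opMatrix fun i j => u (x i j)‖ ≤ ‖opMatrix fun i j => (x i j : E →L[ℂ] E)‖

end NCDomain

end

/-!
Write `‖T‖_f² = sup_{‖x‖ = 1} ∑ a_α ‖T_α^* x‖²`. Membership in the domain gives `‖T‖_f ≤ 1`, hence
`‖rT‖_f ≤ r < 1`, and this strict row bound forces purity, spectral radius `< 1` and the
convergence of the resolvent series. The coefficients of `(1 - f)⁻ᵐ` are the `b_α`, so inverting
`I - ∑ a_α~ Λ_α ⊗ T_α~^*` produces the Berezin kernel and `B_{rT}[g] = K_{rT}^* (g ⊗ I) K_{rT}`.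

For pure tuples `∑ b_α T_α Δ² T_α^* = I`, so the kernel is an isometry; it intertwines `W_i^* ⊗ I`
with `T_i^*`, which makes `W ⊗ I` a dilation of `rT`. The maps `B_{rT}` are therefore unital
complete contractions sending `W_α W_β^*` to `(rT)_α (rT)_β^*`. These images converge as `r → 1`,
and uniformly bounded maps that converge on a spanning set converge on its closed span. If `T`
itself is pure, `K_T` is one more dilation, and the limit agrees with `K_T^* (g ⊗ I) K_T` on words.
-/

noncomputable section

namespace NCDomain

open scoped ENNReal NNReal

/-! ### Coefficients of noncommutative power series -/

section WordCoefficients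

variable {ι R : Type*} [CommSemiring R]

/-- The coefficients of the product of two formal power series in noncommuting variables with
coefficients `u` and `v`. -/
def wordMul (u v : List ι → R) (δ : List ι) : R :=
  ∑ i ∈ Finset.range (δ.length + 1), u (δ.take i) * v (δ.drop i)

/-- The coefficients of the `j`-th power of the formal power series with coefficients `a`. -/
def wordPow (a : List ι → R) : ℕ → List ι → R
  | 0 => fun δ => if δ = [] then 1 else 0
  | j + 1 => wordMul (wordPow a j) a

/-- The coefficients of `(1 - g)⁻ᵏ` for the formal power series `g` with coefficients `a`. Powers
of `g` beyond the length of the word are left out: they do not contribute if `a [] = 0`. -/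
def invOneSubPow (a : List ι → R) (k : ℕ) (δ : List ι) : R :=
  ∑ j ∈ Finset.range (δ.length + 1), k.multichoose j * wordPow a j δ

variable {a : List ι → R}

theorem wordPow_eq_zero_of_length_lt (ha : a [] = 0) {j : ℕ} {δ : List ι} (h : δ.length < j) :
    wordPow a j δ = 0 := by
  induction j generalizing δ with
  | zero => omega
  | succ j ih =>
    rw [wordPow, wordMul]
    refine Finset.sum_eq_zero fun i _ => ?_
    rcases lt_or_ge i δ.length with hi | hi
    · rw [ih (by rw [List.length_take]; omega), zero_mul]
    · rw [List.drop_eq_nil_of_le hi, ha, mul_zero]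

theorem invOneSubPow_eq_sum_range (ha : a [] = 0) (k : ℕ) {δ : List ι} {N : ℕ}
    (hN : δ.length < N) :
    invOneSubPow a k δ = ∑ j ∈ Finset.range N, k.multichoose j * wordPow a j δ := by
  refine Finset.sum_subset (Finset.range_mono hN) fun j _ hj => ?_
  rw [wordPow_eq_zero_of_length_lt ha (by simpa using hj), mul_zero]

theorem invOneSubPow_zero (a : List ι → R) (δ : List ι) :
    invOneSubPow a 0 δ = if δ = [] then 1 else 0 := by
  rw [invOneSubPow, Finset.sum_range_succ']
  simp [wordPow]

theorem wordMul_invOneSubPow (ha : a [] = 0) (k : ℕ) (δ : List ι) :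
    wordMul (invOneSubPow a k) a δ =
      ∑ j ∈ Finset.range δ.length, k.multichoose j * wordPow a (j + 1) δ :=
  calc wordMul (invOneSubPow a k) a δ
      = ∑ i ∈ Finset.range (δ.length + 1), ∑ j ∈ Finset.range (δ.length + 1),
          k.multichoose j * (wordPow a j (δ.take i) * a (δ.drop i)) := by
        refine Finset.sum_congr rfl fun i _ => ?_
        rw [invOneSubPow_eq_sum_range ha k (N := δ.length + 1)
          (by rw [List.length_take]; omega), Finset.sum_mul]
        exact Finset.sum_congr rfl fun j _ => mul_assoc _ _ _
    _ = ∑ j ∈ Finset.range (δ.length + 1), k.multichoose j * wordPow a (j + 1) δ := by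
        rw [Finset.sum_comm]
        simp only [← Finset.mul_sum]
        rfl
    _ = _ := by
        rw [Finset.sum_range_succ, wordPow_eq_zero_of_length_lt ha (Nat.lt_succ_self _), mul_zero,
          add_zero]

theorem invOneSubPow_succ (ha : a [] = 0) (k : ℕ) (δ : List ι) :
    invOneSubPow a (k + 1) δ =
      invOneSubPow a k δ + wordMul (invOneSubPow a (k + 1)) a δ := by
  rw [wordMul_invOneSubPow ha, invOneSubPow, invOneSubPow, Finset.sum_range_succ',
    Finset.sum_range_succ' _ δ.length, Nat.multichoose_zero_right, Nat.multichoose_zero_right,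
    add_right_comm, ← Finset.sum_add_distrib]
  simp only [Nat.multichoose_succ_succ, Nat.cast_add, add_mul]

section Ordered

variable [PartialOrder R] [IsOrderedRing R]

theorem wordMul_nonneg {u v : List ι → R} (hu : 0 ≤ u) (hv : 0 ≤ v) : 0 ≤ wordMul u v :=
  fun _ => Finset.sum_nonneg fun _ _ => mul_nonneg (hu _) (hv _)

theorem wordPow_nonneg (ha : 0 ≤ a) (j : ℕ) : 0 ≤ wordPow a j := by
  induction j with
  | zero => intro δ; simp only [wordPow]; split_ifs <;> simp
  | succ j ih => exact wordMul_nonneg ih ha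

theorem invOneSubPow_nonneg (ha : 0 ≤ a) (k : ℕ) : 0 ≤ invOneSubPow a k :=
  fun δ => Finset.sum_nonneg fun j _ => mul_nonneg (Nat.cast_nonneg _) (wordPow_nonneg ha j δ)

end Ordered

end WordCoefficients

section Compositions

variable {ι R : Type*} [CommSemiring R]

/-- The composition of `N` with last block `N - i` that extends a composition of `i < N`. -/
def snocComposition {N : ℕ} (i : Fin N) (c : Composition i) : Composition N where
  blocks := c.blocks ++ [N - i]
  blocks_pos := by
    intro k hk
    rcases List.mem_append.1 hk with hk | hk
    · exact c.blocks_pos hk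
    · rw [List.mem_singleton.1 hk]; omega
  blocks_sum := by simp [c.blocks_sum]

theorem snocComposition_bijective {N : ℕ} (hN : 0 < N) :
    Function.Bijective fun p : Σ i : Fin N, Composition (i : ℕ) => snocComposition p.1 p.2 := by
  constructor
  · rintro ⟨i, c⟩ ⟨j, d⟩ h
    obtain ⟨hblocks, hlast⟩ := List.append_inj' (congrArg Composition.blocks h) rfl
    have hij : i = j := by
      have : N - i = N - j := List.singleton_inj.1 hlast
      omega
    subst hij
    rw [show c = d from Composition.ext hblocks]
  · intro c
    have hne : c.blocks ≠ [] := by simpa using hN.ne'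
    have hsum : c.blocks.dropLast.sum + c.blocks.getLast hne = N := by
      conv_rhs => rw [← c.blocks_sum, ← List.dropLast_append_getLast hne]
      simp
    have hpos : 0 < c.blocks.getLast hne := c.blocks_pos (List.getLast_mem hne)
    refine ⟨⟨⟨c.blocks.dropLast.sum, by omega⟩,
      ⟨c.blocks.dropLast, fun hk => c.blocks_pos (List.dropLast_subset _ hk), rfl⟩⟩, ?_⟩
    refine Composition.ext ?_
    simp only [snocComposition]
    rw [show N - c.blocks.dropLast.sum = c.blocks.getLast hne by omega]
    exact List.dropLast_append_getLast hne

theorem snocComposition_length {N : ℕ} (i : Fin N) (c : Composition i) :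
    (snocComposition i c).length = c.length + 1 := by
  simp [snocComposition, Composition.length]

theorem splitWrtCompositionAux_append (β : List ι) : ∀ (ns : List ℕ) (α : List ι),
    ns.sum = α.length → (α ++ β).splitWrtCompositionAux (ns ++ [β.length]) =
      α.splitWrtCompositionAux ns ++ [β]
  | [], α, h => by
    obtain rfl : α = [] := List.length_eq_zero_iff.1 h.symm
    simp [List.splitWrtCompositionAux]
  | k :: ns, α, h => by
    rw [List.sum_cons] at h
    have hk : k ≤ α.length := by omega
    have hns : ns.sum = (α.drop k).length := by rw [List.length_drop]; omega
    rw [List.cons_append, List.splitWrtCompositionAux_cons, List.splitWrtCompositionAux_cons,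
      List.take_append_of_le_length hk, List.drop_append_of_le_length hk,
      splitWrtCompositionAux_append β ns _ hns, List.cons_append]

theorem splitWrtComposition_snocComposition {N : ℕ} {δ : List ι} (hδ : δ.length = N) (i : Fin N)
    (c : Composition i) : δ.splitWrtComposition (snocComposition i c) =
      (δ.take i).splitWrtComposition c ++ [δ.drop i] := by
  have h := splitWrtCompositionAux_append (δ.drop i) c.blocks (δ.take i)
    (by rw [c.blocks_sum, List.length_take]; omega)
  rwa [List.take_append_drop, List.length_drop, hδ] at h

/-- The sum, over all factorizations of the word `δ` into nonempty words, of the product of the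
coefficients of the factors, with a weight depending on the number of factors. -/
def factorizationSum (a : List ι → R) (w : ℕ → R) (δ : List ι) : R :=
  ∑ c : Composition δ.length, ((δ.splitWrtComposition c).map a).prod * w c.length

theorem factorizationSum_nil (a : List ι → R) (w : ℕ → R) : factorizationSum a w [] = w 0 := by
  have hblocks (c : Composition ([] : List ι).length) : c.blocks = [] := c.blocks_eq_nil.2 rfl
  have : Subsingleton (Composition ([] : List ι).length) :=
    ⟨fun c d => Composition.ext ((hblocks c).trans (hblocks d).symm)⟩
  rw [factorizationSum, Fintype.sum_subsingleton _ (default : Composition ([] : List ι).length)]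
  simp [List.splitWrtComposition, Composition.length, hblocks, List.splitWrtCompositionAux]

theorem factorizationSum_of_ne_nil {a : List ι → R} (ha : a [] = 0) (w : ℕ → R) {δ : List ι}
    (hδ : δ ≠ []) : factorizationSum a w δ =
      wordMul (factorizationSum a fun j => w (j + 1)) a δ := by
  have hsnoc : ∀ i : Fin δ.length, ∑ c : Composition i,
      ((δ.splitWrtComposition (snocComposition i c)).map a).prod *
        w (snocComposition i c).length =
      factorizationSum a (fun j => w (j + 1)) (δ.take i) * a (δ.drop i) := by
    intro i
    have hi : (δ.take i).length = i := by rw [List.length_take]; omega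
    rw [factorizationSum, hi, Finset.sum_mul]
    refine Finset.sum_congr rfl fun c _ => ?_
    rw [splitWrtComposition_snocComposition rfl, snocComposition_length, List.map_append,
      List.prod_append, List.map_singleton, List.prod_singleton, mul_right_comm]
  rw [factorizationSum, wordMul, Finset.sum_range_succ, List.drop_length, ha, mul_zero, add_zero,
    Finset.sum_range,
    ← (Equiv.ofBijective _ (snocComposition_bijective (List.length_pos_iff.2 hδ))).sum_comp,
    Fintype.sum_sigma]
  exact Finset.sum_congr rfl fun i _ => hsnoc i

theorem factorizationSum_eq_sum_wordPow {a : List ι → R} (ha : a [] = 0) {N : ℕ} (w : ℕ → R)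
    {δ : List ι} (hN : δ.length < N) :
    factorizationSum a w δ = ∑ j ∈ Finset.range N, w j * wordPow a j δ := by
  induction N generalizing w δ with
  | zero => omega
  | succ N ih =>
    rw [Finset.sum_range_succ']
    rcases eq_or_ne δ [] with rfl | hδ
    · rw [factorizationSum_nil, Finset.sum_eq_zero fun j _ => by
        rw [wordPow_eq_zero_of_length_lt ha j.succ_pos, mul_zero]]
      simp [wordPow]
    · rw [factorizationSum_of_ne_nil ha w hδ]
      simp only [wordPow, if_neg hδ, mul_zero, add_zero, wordMul, Finset.mul_sum]
      rw [Finset.sum_comm]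
      refine Finset.sum_congr rfl fun i hi => ?_
      rcases (Nat.lt_succ_iff.1 (Finset.mem_range.1 hi)).eq_or_lt with rfl | hi
      · simp [ha]
      · rw [ih _ (by rw [List.length_take]; omega), Finset.sum_mul]
        exact Finset.sum_congr rfl fun j _ => mul_assoc _ _ _

end Compositions

section PosRegular

variable {n : ℕ} (f : PosRegular n)

theorem PosRegular.b_eq_factorizationSum (m : ℕ) : f.b m =
    factorizationSum f.coeff fun j => ((j + m - 1).choose (m - 1) : ℝ) := rfl

theorem PosRegular.b_eq_invOneSubPow {m : ℕ} (hm : 1 ≤ m) : f.b m = invOneSubPow f.coeff m := by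
  ext δ
  rw [f.b_eq_factorizationSum,
    factorizationSum_eq_sum_wordPow f.coeff_nil _ (Nat.lt_succ_self _), invOneSubPow]
  refine Finset.sum_congr rfl fun j _ => ?_
  congr 2
  rw [Nat.multichoose_eq, Nat.choose_symm_of_eq_add (b := j) (by omega), add_comm j m]

theorem PosRegular.b_nil (m : ℕ) : f.b m [] = 1 := by
  rw [f.b_eq_factorizationSum, factorizationSum_nil]
  simp

theorem PosRegular.b_pos (m : ℕ) (δ : List (Fin n)) : 0 < f.b m δ := by
  induction δ with
  | nil => rw [f.b_nil]; exact one_pos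
  | cons i δ ih => exact (mul_pos (f.coeff_letter i) ih).trans_le (f.b_cons_ge m i δ)

theorem PosRegular.wordMul_b_coeff_le {m : ℕ} (hm : 1 ≤ m) :
    wordMul (f.b m) f.coeff ≤ f.b m := by
  obtain ⟨k, rfl⟩ := Nat.exists_eq_add_of_le' hm
  intro δ
  rw [f.b_eq_invOneSubPow hm, invOneSubPow_succ f.coeff_nil k δ]
  exact le_add_of_nonneg_left (invOneSubPow_nonneg (a := f.coeff) f.coeff_nonneg k δ)

end PosRegular

/-! ### Nonnegative sums over words -/

section Sums

/-- Pairs of words correspond to words with a marked cut. -/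
def cutEquiv (ι : Type*) : (Σ δ : List ι, Fin (δ.length + 1)) ≃ List ι × List ι where
  toFun p := (p.1.take p.2, p.1.drop p.2)
  invFun q := ⟨q.1 ++ q.2, ⟨q.1.length, by simp⟩⟩
  left_inv := by
    rintro ⟨δ, i, hi⟩
    have h : δ.take i ++ δ.drop i = δ := List.take_append_drop i δ
    refine Sigma.ext h ?_
    rw [Fin.heq_ext_iff (congrArg (fun l => l.length + 1) h)]
    exact List.length_take_of_le (Nat.le_of_lt_succ hi)
  right_inv q := by simp

theorem tsum_tsum_eq_tsum_sum_cut {ι : Type*} (F : List ι → List ι → ℝ≥0∞) :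
    ∑' γ, ∑' β, F γ β =
      ∑' δ : List ι, ∑ i ∈ Finset.range (δ.length + 1), F (δ.take i) (δ.drop i) := by
  rw [← ENNReal.tsum_prod, ← (cutEquiv ι).tsum_eq, ENNReal.tsum_sigma']
  refine tsum_congr fun δ => ?_
  rw [tsum_fintype, Finset.sum_range]
  rfl

theorem tsum_reverse {ι : Type*} (F : List ι → ℝ≥0∞) :
    ∑' α : List ι, F α.reverse = ∑' α, F α :=
  (List.reverse_involutive (α := ι)).toPerm.tsum_eq F

theorem tsum_multichoose_succ_mul (k : ℕ) (x : ℕ → ℝ≥0∞) :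
    ∑' j, ((k + 1).multichoose j : ℝ≥0∞) * x j =
      ∑' i, (k.multichoose i : ℝ≥0∞) * ∑' j, x (j + i) := by
  simp only [← ENNReal.tsum_mul_left]
  rw [← ENNReal.tsum_prod, ← Finset.HasAntidiagonal.sigmaAntidiagonalEquivProd.tsum_eq,
    ENNReal.tsum_sigma']
  refine tsum_congr fun j => ?_
  have hsum : (k + 1).multichoose j =
      ∑ p ∈ Finset.HasAntidiagonal.antidiagonal j, k.multichoose p.1 := by
    rw [Finset.Nat.sum_antidiagonal_eq_sum_range_succ_mk, Nat.sum_range_multichoose,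
      Nat.multichoose_eq, Nat.choose_symm_of_eq_add (b := k) (by omega)]
    congr 1
    omega
  have hterm : ∀ p ∈ Finset.HasAntidiagonal.antidiagonal j,
      (k.multichoose p.1 : ℝ≥0∞) * x (p.2 + p.1) = k.multichoose p.1 * x j := fun p hp => by
    rw [add_comm p.2, Finset.HasAntidiagonal.mem_antidiagonal.1 hp]
  rw [tsum_fintype, hsum, Nat.cast_sum, Finset.sum_mul, ← Finset.sum_congr rfl hterm]
  exact (Finset.sum_coe_sort _ fun p : ℕ × ℕ => (k.multichoose p.1 : ℝ≥0∞) * x (p.2 + p.1)).symm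

theorem tsum_add_eq_of_add_succ_eq {x y : ℕ → ℝ≥0∞} (hxy : ∀ j, y j + x (j + 1) = x j)
    (hx : Tendsto x atTop (𝓝 0)) (j : ℕ) : ∑' i, y (i + j) = x j := by
  have hpartial : ∀ N, ∑ i ∈ Finset.range N, y (i + j) + x (N + j) = x j := by
    intro N
    induction N with
    | zero => simp
    | succ N ih => rw [Finset.sum_range_succ, add_assoc, add_right_comm N 1 j, hxy, ih]
  have hlim : Tendsto (fun N => ∑ i ∈ Finset.range N, y (i + j) + x (N + j)) atTop
      (𝓝 (∑' i, y (i + j) + 0)) :=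
    (ENNReal.tendsto_nat_tsum _).add ((tendsto_add_atTop_iff_nat j).2 hx)
  simp only [hpartial, add_zero] at hlim
  exact tendsto_nhds_unique hlim tendsto_const_nhds

/-- Iterated summation by parts; `hd` is stated without subtraction, which truncates in `ℝ≥0∞`. -/
theorem tsum_multichoose_mul_eq {m : ℕ} (d : ℕ → ℕ → ℝ≥0∞)
    (hd : ∀ k < m, ∀ j, d (k + 1) j + d k (j + 1) = d k j)
    (hlim : Tendsto (d 0) atTop (𝓝 0)) :
    ∑' j, (m.multichoose j : ℝ≥0∞) * d m j = d 0 0 := by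
  have hlim' : ∀ k ≤ m, Tendsto (d k) atTop (𝓝 0) := by
    intro k hk
    induction k with
    | zero => exact hlim
    | succ k ih =>
      refine tendsto_of_tendsto_of_tendsto_of_le_of_le tendsto_const_nhds (ih (by omega))
        (fun _ => zero_le) fun j => ?_
      rw [← hd k hk j]
      exact le_self_add
  induction m with
  | zero =>
    have hzero : ∀ j ≠ 0, (Nat.multichoose 0 j : ℝ≥0∞) * d 0 j = 0 := by
      intro j hj
      obtain ⟨i, rfl⟩ := Nat.exists_eq_succ_of_ne_zero hj
      simp
    rw [tsum_eq_single 0 hzero]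
    simp
  | succ m ih =>
    rw [tsum_multichoose_succ_mul,
      ← ih (fun k hk => hd k (by omega)) fun k hk => hlim' k (by omega)]
    simp only [tsum_add_eq_of_add_succ_eq (hd m m.lt_succ_self) (hlim' m m.le_succ)]

end Sums

section Mono

variable {n : ℕ} {A : Type*} [Monoid A] (X : Fin n → A)

theorem mono_nil : mono X [] = 1 := rfl

theorem mono_cons (i : Fin n) (α : List (Fin n)) : mono X (i :: α) = X i * mono X α := by
  simp [mono]

theorem mono_append (α β : List (Fin n)) : mono X (α ++ β) = mono X α * mono X β := by
  simp [mono]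

end Mono

section FormMap

variable {n : ℕ} {H : Type*} [NormedAddCommGroup H] [InnerProductSpace ℂ H] [CompleteSpace H]
  (f : PosRegular n) (T : Fin n → H →L[ℂ] H)

/-- The action of `Φ_{f,T}` on nonnegative forms, `q ↦ ∑ a_α q(T_α^* h)`. Forms take values in
`[0, ∞]`, so that sums of forms may be rearranged freely. -/
def formMap (q : H → ℝ≥0∞) (h : H) : ℝ≥0∞ :=
  ∑' α, ENNReal.ofReal (f.coeff α) * q (star (mono T α) h)

theorem formMap_mono : Monotone (formMap f T) :=
  fun _ _ h _ => ENNReal.tsum_le_tsum fun _ => mul_le_mul_right (h _) _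

theorem formMap_add (p q : H → ℝ≥0∞) :
    formMap f T (p + q) = formMap f T p + formMap f T q := by
  ext h
  simp only [formMap, Pi.add_apply, mul_add, ENNReal.tsum_add]

theorem formMap_smul (c : ℝ≥0∞) (q : H → ℝ≥0∞) :
    formMap f T (c • q) = c • formMap f T q := by
  ext h
  simp only [formMap, Pi.smul_apply, smul_eq_mul, ← ENNReal.tsum_mul_left, mul_left_comm c]

theorem iterate_formMap_mono (j : ℕ) : Monotone (formMap f T)^[j] :=
  (formMap_mono f T).iterate j

theorem iterate_formMap_smul (j : ℕ) (c : ℝ≥0∞) (q : H → ℝ≥0∞) :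
    (formMap f T)^[j] (c • q) = c • (formMap f T)^[j] q :=
  Function.Commute.iterate_left (formMap_smul f T c) j q

theorem iterate_formMap_add (j : ℕ) (p q : H → ℝ≥0∞) :
    (formMap f T)^[j] (p + q) = (formMap f T)^[j] p + (formMap f T)^[j] q := by
  induction j with
  | zero => rfl
  | succ j ih => simp only [Function.iterate_succ_apply', ih, formMap_add]

theorem iterate_formMap (j : ℕ) (q : H → ℝ≥0∞) (h : H) : (formMap f T)^[j] q h =
    ∑' α, ENNReal.ofReal (wordPow f.coeff j α) * q (star (mono T α) h) := by
  induction j generalizing q with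
  | zero =>
    rw [tsum_eq_single []]
    · simp [wordPow, mono_nil]
    · intro α hα; simp [wordPow, hα]
  | succ j ih =>
    have hpow : ∀ α, 0 ≤ wordPow f.coeff j α := wordPow_nonneg (a := f.coeff) f.coeff_nonneg j
    rw [Function.iterate_succ_apply, ih]
    simp only [formMap, ← ENNReal.tsum_mul_left]
    rw [tsum_tsum_eq_tsum_sum_cut fun γ β => ENNReal.ofReal (wordPow f.coeff j γ) *
      (ENNReal.ofReal (f.coeff β) * q (star (mono T β) (star (mono T γ) h)))]
    refine tsum_congr fun δ => ?_
    rw [wordPow, wordMul, ENNReal.ofReal_sum_of_nonneg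
      fun i _ => mul_nonneg (hpow _) (f.coeff_nonneg _), Finset.sum_mul]
    refine Finset.sum_congr rfl fun i _ => ?_
    rw [ENNReal.ofReal_mul (hpow _), mul_assoc, ← mul_apply_eq_comp, ← star_mul, ← mono_append,
      List.take_append_drop]

theorem tsum_invOneSubPow_mul_form (k : ℕ) (q : H → ℝ≥0∞) (h : H) :
    ∑' α, ENNReal.ofReal (invOneSubPow f.coeff k α) * q (star (mono T α) h) =
      ∑' j, (k.multichoose j : ℝ≥0∞) * (formMap f T)^[j] q h := by
  simp only [iterate_formMap, ← ENNReal.tsum_mul_left, ← mul_assoc]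
  rw [ENNReal.tsum_comm]
  refine tsum_congr fun α => ?_
  rw [ENNReal.tsum_mul_right, tsum_eq_sum (s := Finset.range (α.length + 1)), invOneSubPow,
    ENNReal.ofReal_sum_of_nonneg fun j _ =>
      mul_nonneg (Nat.cast_nonneg _) (wordPow_nonneg (a := f.coeff) f.coeff_nonneg j α)]
  · simp only [ENNReal.ofReal_mul (Nat.cast_nonneg _), ENNReal.ofReal_natCast]
  · intro j hj
    rw [wordPow_eq_zero_of_length_lt f.coeff_nil (by simpa using hj), ENNReal.ofReal_zero,
      mul_zero]

end FormMap

/-! ### Operators on Hilbert tensor products -/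

section Tensor

variable {E F : Type*} [NormedAddCommGroup E] [InnerProductSpace ℂ E]
  [NormedAddCommGroup F] [InnerProductSpace ℂ F]

theorem tensorVec_apply (x : E) (y : F) :
    tensorVec F x y = ((x ⊗ₜ[ℂ] y : E ⊗[ℂ] F) : HTensor E F) := rfl

theorem tensorVec_smul (c : ℂ) (x : E) : tensorVec F (c • x) = c • tensorVec F x := by
  ext y
  simp [tensorVec]

theorem tensorVec_add (x x' : E) : tensorVec F (x + x') = tensorVec F x + tensorVec F x' := by
  ext y
  simp [tensorVec]

theorem inner_tensorVec (x x' : E) (y y' : F) :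
    inner ℂ (tensorVec F x y) (tensorVec F x' y') = inner ℂ x x' * inner ℂ y y' := by
  rw [tensorVec_apply, tensorVec_apply, UniformSpace.Completion.inner_coe,
    TensorProduct.inner_tmul]

theorem tensorOp_tensorVec (A : E →L[ℂ] E) (B : F →L[ℂ] F) (x : E) (y : F) :
    tensorOp A B (tensorVec F x y) = tensorVec F (A x) (B y) := by
  rw [tensorVec_apply, tensorOp, ContinuousLinearMap.completion_apply_coe]
  rfl

theorem HTensor.clm_ext {G : Type*} [NormedAddCommGroup G] [NormedSpace ℂ G]
    {A B : HTensor E F →L[ℂ] G} (h : ∀ x y, A (tensorVec F x y) = B (tensorVec F x y)) :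
    A = B := by
  ext v
  induction v using UniformSpace.Completion.induction_on with
  | hp => exact isClosed_eq A.continuous B.continuous
  | ih v =>
    induction v using TensorProduct.induction_on with
    | zero => rw [UniformSpace.Completion.coe_zero, map_zero, map_zero]
    | tmul x y => exact h x y
    | add v w hv hw => rw [UniformSpace.Completion.coe_add, map_add, map_add, hv, hw]

theorem HTensor.ext_inner {v w : HTensor E F}
    (h : ∀ x y, inner ℂ v (tensorVec F x y) = inner ℂ w (tensorVec F x y)) : v = w := by
  have hvw : innerSL ℂ v = innerSL ℂ w :=
    HTensor.clm_ext fun x y => by simpa only [innerSL_apply_apply] using h x y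
  exact ext_inner_right ℂ fun u => by
    simpa only [innerSL_apply_apply] using DFunLike.congr_fun hvw u

theorem tensorOp_one : tensorOp (1 : E →L[ℂ] E) (1 : F →L[ℂ] F) = 1 :=
  HTensor.clm_ext fun x y => tensorOp_tensorVec 1 1 x y

theorem tensorOp_mul (A A' : E →L[ℂ] E) (B B' : F →L[ℂ] F) :
    tensorOp (A * A') (B * B') = tensorOp A B * tensorOp A' B' :=
  HTensor.clm_ext fun x y => by simp only [mul_apply_eq_comp, tensorOp_tensorVec]

theorem tensorOp_add_left (A A' : E →L[ℂ] E) (B : F →L[ℂ] F) :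
    tensorOp (A + A') B = tensorOp A B + tensorOp A' B :=
  HTensor.clm_ext fun x y => by simp [tensorOp_tensorVec, tensorVec_add]

theorem tensorOp_smul_left (c : ℂ) (A : E →L[ℂ] E) (B : F →L[ℂ] F) :
    tensorOp (c • A) B = c • tensorOp A B :=
  HTensor.clm_ext fun x y => by simp [tensorOp_tensorVec, tensorVec_smul]

variable [CompleteSpace E] [CompleteSpace F]

theorem star_tensorOp (A : E →L[ℂ] E) (B : F →L[ℂ] F) :
    star (tensorOp A B) = tensorOp (star A) (star B) := by
  refine HTensor.clm_ext fun x y => HTensor.ext_inner fun x' y' => ?_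
  rw [ContinuousLinearMap.star_eq_adjoint, ContinuousLinearMap.adjoint_inner_left,
    tensorOp_tensorVec, tensorOp_tensorVec, inner_tensorVec, inner_tensorVec,
    ContinuousLinearMap.star_eq_adjoint, ContinuousLinearMap.star_eq_adjoint,
    ContinuousLinearMap.adjoint_inner_left, ContinuousLinearMap.adjoint_inner_left]

variable (E F) in
/-- The representation `A ↦ A ⊗ I` of the operators on `E` on the Hilbert tensor product. -/
def ampliation : (E →L[ℂ] E) →⋆ₐ[ℂ] (HTensor E F →L[ℂ] HTensor E F) where
  toFun A := tensorOp A 1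
  map_one' := tensorOp_one
  map_mul' A A' := by rw [← tensorOp_mul, one_mul]
  map_zero' := by
    simpa only [zero_smul] using tensorOp_smul_left (0 : ℂ) (0 : E →L[ℂ] E) (1 : F →L[ℂ] F)
  map_add' A A' := tensorOp_add_left A A' 1
  commutes' c := by
    rw [Algebra.algebraMap_eq_smul_one, Algebra.algebraMap_eq_smul_one, tensorOp_smul_left,
      tensorOp_one]
  map_star' A := by rw [star_tensorOp, star_one]

theorem ampliation_apply (A : E →L[ℂ] E) : ampliation E F A = tensorOp A 1 := rfl

end Tensor

/-! ### Sums in the weak operator topology -/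

section WOT

variable {ι E F : Type*} [NormedAddCommGroup E] [InnerProductSpace ℂ E]
  [NormedAddCommGroup F] [InnerProductSpace ℂ F]

/-- `∑ u_i = S` in the weak operator topology. -/
def HasWOTSum (u : ι → E →L[ℂ] F) (S : E →L[ℂ] F) : Prop :=
  HasSum (fun i => ContinuousLinearMapWOT.ofCLM (u i)) (ContinuousLinearMapWOT.ofCLM S)

theorem HasWOTSum.wotSummable {u : ι → E →L[ℂ] F} {S : E →L[ℂ] F} (h : HasWOTSum u S) :
    WOTSummable u :=
  h.summable

theorem WOTSummable.hasWOTSum {u : ι → E →L[ℂ] F} (h : WOTSummable u) :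
    HasWOTSum u (wotSum u) :=
  h.hasSum

theorem HasWOTSum.wotSum_eq {u : ι → E →L[ℂ] F} {S : E →L[ℂ] F} (h : HasWOTSum u S) :
    wotSum u = S := by
  rw [wotSum, HasSum.tsum_eq h]

variable [CompleteSpace F] {u : ι → E →L[ℂ] F} {S : E →L[ℂ] F}

theorem hasWOTSum_iff_inner :
    HasWOTSum u S ↔ ∀ x y, HasSum (fun i => inner ℂ y (u i x)) (inner ℂ y (S x)) := by
  have hsum : ∀ (s : Finset ι) (x : E) (y : F),
      inner ℂ y ((∑ i ∈ s, ContinuousLinearMapWOT.ofCLM (u i)) x) =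
        ∑ i ∈ s, inner ℂ y (u i x) := by
    classical
    intro s x y
    induction s using Finset.induction_on with
    | empty => simp
    | insert a s ha ih =>
      rw [Finset.sum_insert ha, Finset.sum_insert ha, ← ih, ContinuousLinearMapWOT.add_apply,
        inner_add_right]
      rfl
  simp only [HasWOTSum, HasSum, ContinuousLinearMapWOT.tendsto_iff_forall_inner_apply_tendsto,
    hsum]
  rfl

theorem HasWOTSum.star {u : ι → F →L[ℂ] F} {S : F →L[ℂ] F} (h : HasWOTSum u S) :
    HasWOTSum (fun i => star (u i)) (star S) := by
  refine hasWOTSum_iff_inner.2 fun x y => ?_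
  have hyx := (hasWOTSum_iff_inner.1 h y x).star
  simpa only [RCLike.star_def, inner_conj_symm, ContinuousLinearMap.star_eq_adjoint,
    ContinuousLinearMap.adjoint_inner_right] using hyx

end WOT

/-! ### Columns of operators -/

section Column

variable {ι G : Type*} [NormedAddCommGroup G]

theorem enorm_sq_eq_ofReal (x : G) : ‖x‖ₑ ^ 2 = ENNReal.ofReal (‖x‖ ^ 2) := by
  rw [← ofReal_norm, ENNReal.ofReal_pow (norm_nonneg x)]

theorem enorm_lp_two_sq (w : lp (fun _ : ι => G) 2) : ‖w‖ₑ ^ 2 = ∑' i, ‖w i‖ₑ ^ 2 := by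
  have hw : HasSum (fun i => ‖w i‖ ^ 2) (‖w‖ ^ 2) := by
    simpa using lp.hasSum_norm (p := 2) (by norm_num) w
  simp only [enorm_sq_eq_ofReal]
  rw [← hw.tsum_eq, ENNReal.ofReal_tsum_of_nonneg (fun _ => sq_nonneg _) hw.summable]

theorem memℓp_two_of_tsum_enorm_sq_ne_top {w : ι → G} (h : ∑' i, ‖w i‖ₑ ^ 2 ≠ ∞) :
    Memℓp w 2 := by
  have hs := ENNReal.summable_toReal h
  simp only [ENNReal.toReal_pow, toReal_enorm] at hs
  exact memℓp_gen (by simpa using hs)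

variable {E F : Type*} [NormedAddCommGroup E] [InnerProductSpace ℂ E]
  [NormedAddCommGroup F] [InnerProductSpace ℂ F] [InnerProductSpace ℂ G]

/-- The column `(A_i)` is an operator `E → ℓ²(ι, G)` of norm at most `c`. -/
def ColumnBound (A : ι → E →L[ℂ] G) (c : ℝ≥0) : Prop :=
  ∀ x, ∑' i, ‖A i x‖ₑ ^ 2 ≤ (c * ‖x‖ₑ) ^ 2

variable {A : ι → E →L[ℂ] G} {P : ℝ≥0}

theorem ColumnBound.memℓp (h : ColumnBound A P) (x : E) : Memℓp (fun i => A i x) 2 :=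
  memℓp_two_of_tsum_enorm_sq_ne_top (ne_top_of_le_ne_top
    (ENNReal.pow_ne_top (ENNReal.mul_ne_top ENNReal.coe_ne_top enorm_ne_top)) (h x))

/-- The operator `x ↦ (A_i x)` with values in `ℓ²(ι, G)`. -/
def ColumnBound.op (h : ColumnBound A P) : E →L[ℂ] lp (fun _ : ι => G) 2 :=
  LinearMap.mkContinuous
    { toFun := fun x => ⟨fun i => A i x, h.memℓp x⟩
      map_add' := fun x y => by ext i; exact map_add (A i) x y
      map_smul' := fun c x => by ext i; exact map_smul (A i) c x }
    P fun x => by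
      let w : lp (fun _ : ι => G) 2 := ⟨fun i => A i x, h.memℓp x⟩
      have hw : ‖w‖ₑ ≤ P * ‖x‖ₑ :=
        (ENNReal.pow_le_pow_left_iff two_ne_zero).1 ((enorm_lp_two_sq w).trans_le (h x))
      rw [← ENNReal.toReal_le_toReal enorm_ne_top (by finiteness), ENNReal.toReal_mul,
        toReal_enorm, toReal_enorm, ENNReal.coe_toReal] at hw
      exact hw

theorem ColumnBound.op_apply (h : ColumnBound A P) (x : E) (i : ι) : h.op x i = A i x := rfl

theorem ColumnBound.norm_op_le (h : ColumnBound A P) : ‖h.op‖ ≤ P :=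
  LinearMap.mkContinuous_norm_le _ P.2 _

variable [CompleteSpace F] [CompleteSpace G] {B : ι → F →L[ℂ] G} {Q : ℝ≥0}

theorem ColumnBound.hasWOTSum_adjoint_comp (hA : ColumnBound A P) (hB : ColumnBound B Q) :
    HasWOTSum (fun i => (B i).adjoint ∘L A i) (hB.op.adjoint ∘L hA.op) := by
  refine hasWOTSum_iff_inner.2 fun x y => ?_
  simp only [ContinuousLinearMap.comp_apply, ContinuousLinearMap.adjoint_inner_right]
  exact lp.hasSum_inner (hB.op y) (hA.op x)

theorem ColumnBound.norm_wotSum_adjoint_comp_le (hA : ColumnBound A P) (hB : ColumnBound B Q) :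
    ‖wotSum fun i => (B i).adjoint ∘L A i‖ ≤ Q * P := by
  rw [(hA.hasWOTSum_adjoint_comp hB).wotSum_eq]
  refine (ContinuousLinearMap.opNorm_comp_le _ _).trans ?_
  rw [LinearIsometryEquiv.norm_map]
  exact mul_le_mul hB.norm_op_le hA.norm_op_le (norm_nonneg _) Q.2

end Column

/-! ### Coordinates on `F²(H_n) ⊗ H` -/

section Coordinates

variable {n : ℕ} {H : Type*} [NormedAddCommGroup H] [InnerProductSpace ℂ H]

theorem inner_e (α β : List (Fin n)) : inner ℂ (e α) (e β) = if α = β then (1 : ℂ) else 0 :=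
  orthonormal_iff_ite.1 orthonormal_e α β

theorem HTensor.clm_ext_e {G : Type*} [NormedAddCommGroup G] [NormedSpace ℂ G]
    {A B : HTensor (Fock n) H →L[ℂ] G}
    (h : ∀ α y, A (tensorVec H (e α) y) = B (tensorVec H (e α) y)) : A = B := by
  refine HTensor.clm_ext fun x y => ?_
  let J : Fock n →L[ℂ] HTensor (Fock n) H :=
    UniformSpace.Completion.toComplL ∘L (TensorProduct.mkL ℂ (Fock n) H).flip y
  have hJ : A ∘L J = B ∘L J := by
    refine lp.ext_continuousLinearMap (by norm_num) fun α => ?_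
    ext
    exact h α y
  exact DFunLike.congr_fun hJ x

variable (H) in
/-- The isometry `y ↦ e_α ⊗ y`. -/
def coordIsometry (α : List (Fin n)) : H →ₗᵢ[ℂ] HTensor (Fock n) H where
  toLinearMap := (tensorVec H (e α)).toLinearMap
  norm_map' y := by
    change ‖tensorVec H (e α) y‖ = ‖y‖
    rw [tensorVec_apply, UniformSpace.Completion.norm_coe, TensorProduct.norm_tmul,
      orthonormal_e.1 α, one_mul]

theorem coordIsometry_apply (α : List (Fin n)) (y : H) :
    coordIsometry H α y = tensorVec H (e α) y := rfl

theorem orthogonalFamily_coordIsometry :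
    OrthogonalFamily ℂ (fun _ : List (Fin n) => H) (coordIsometry H) := by
  intro α β hαβ x y
  rw [coordIsometry_apply, coordIsometry_apply, inner_tensorVec, inner_e, if_neg hαβ, zero_mul]

variable [CompleteSpace H]

variable (H) in
theorem isHilbertSum_coordIsometry :
    IsHilbertSum ℂ (fun _ : List (Fin n) => H) (coordIsometry H) := by
  refine IsHilbertSum.mk orthogonalFamily_coordIsometry ?_
  rw [top_le_iff, Submodule.topologicalClosure_eq_top_iff, Submodule.eq_bot_iff]
  intro v hv
  have hzero : innerSL ℂ v = 0 := HTensor.clm_ext_e fun α y =>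
    Submodule.inner_left_of_mem_orthogonal
      (Submodule.mem_iSup_of_mem (p := fun α => LinearMap.range (coordIsometry H α).toLinearMap) α
        ⟨y, rfl⟩) hv
  exact innerSL_inj.1 (hzero.trans (map_zero _).symm)

variable (H) in
/-- The coordinate map `e_α ⊗ y ↦ y`. -/
def coord (α : List (Fin n)) : HTensor (Fock n) H →L[ℂ] H :=
  (tensorVec H (e α)).adjoint

theorem inner_coord_right (α : List (Fin n)) (y : H) (v : HTensor (Fock n) H) :
    inner ℂ y (coord H α v) = inner ℂ (tensorVec H (e α) y) v :=
  ContinuousLinearMap.adjoint_inner_right _ _ _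

theorem coord_tensorVec (α β : List (Fin n)) (y : H) :
    coord H α (tensorVec H (e β) y) = if α = β then y else 0 := by
  refine ext_inner_left ℂ fun z => ?_
  rw [inner_coord_right, inner_tensorVec, inner_e]
  split_ifs <;> simp

theorem coord_linearIsometryEquiv_symm (w : lp (fun _ : List (Fin n) => H) 2)
    (α : List (Fin n)) :
    coord H α ((isHilbertSum_coordIsometry H).linearIsometryEquiv.symm w) = w α := by
  have hsum := ((isHilbertSum_coordIsometry H).hasSum_linearIsometryEquiv_symm w).mapL (coord H α)
  simp only [coordIsometry_apply, coord_tensorVec] at hsum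
  rw [hsum.tsum_eq.symm, tsum_eq_single α fun β hβ => if_neg hβ.symm, if_pos rfl]

theorem tsum_enorm_coord_sq (v : HTensor (Fock n) H) :
    ∑' α, ‖coord H α v‖ₑ ^ 2 = ‖v‖ₑ ^ 2 := by
  obtain ⟨w, rfl⟩ := (isHilbertSum_coordIsometry (n := n) H).linearIsometryEquiv.symm.surjective v
  simp only [coord_linearIsometryEquiv_symm]
  rw [LinearIsometryEquiv.enorm_map, enorm_lp_two_sq]

theorem coord_ext {v w : HTensor (Fock n) H} (h : ∀ α, coord H α v = coord H α w) : v = w := by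
  have hsq := tsum_enorm_coord_sq (v - w)
  simp only [map_sub, h, sub_self, enorm_zero, ne_eq, OfNat.ofNat_ne_zero, not_false_eq_true,
    zero_pow, tsum_zero] at hsq
  rwa [eq_comm, sq_eq_zero_iff, enorm_eq_zero, sub_eq_zero] at hsq

section Shift

variable {A : Fock n →L[ℂ] Fock n} {c : List (Fin n) → ℝ} {σ : List (Fin n) → List (Fin n)}

theorem coord_tensorOp_shift (hσ : σ.Injective) (hA : ∀ γ, A (e γ) = (c γ : ℂ) • e (σ γ))
    (B : H →L[ℂ] H) (γ : List (Fin n)) (v : HTensor (Fock n) H) :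
    coord H (σ γ) (tensorOp A B v) = (c γ : ℂ) • B (coord H γ v) := by
  have hclm : coord H (σ γ) ∘L tensorOp A B = (c γ : ℂ) • (B ∘L coord H γ) :=
    HTensor.clm_ext_e fun α y => by
      simp only [ContinuousLinearMap.comp_apply, smul_apply, tensorOp_tensorVec, hA,
        tensorVec_smul, map_smul, coord_tensorVec, hσ.eq_iff, apply_ite B, map_zero]
      split_ifs with hγα
      · rw [hγα]
      · rw [smul_zero, smul_zero]
  exact DFunLike.congr_fun hclm v

theorem coord_tensorOp_shift_of_notMem_range (hA : ∀ γ, A (e γ) = (c γ : ℂ) • e (σ γ))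
    (B : H →L[ℂ] H) {δ : List (Fin n)} (hδ : δ ∉ Set.range σ) (v : HTensor (Fock n) H) :
    coord H δ (tensorOp A B v) = 0 := by
  have hclm : coord H δ ∘L tensorOp A B = 0 := HTensor.clm_ext_e fun α y => by
    have hne : δ ≠ σ α := fun h => hδ ⟨α, h.symm⟩
    rw [ContinuousLinearMap.comp_apply, tensorOp_tensorVec, hA, tensorVec_smul, smul_apply,
      map_smul, coord_tensorVec, if_neg hne, smul_zero, zero_apply]
  exact DFunLike.congr_fun hclm v

theorem coord_ampliation_star (hA : ∀ γ, A (e γ) = (c γ : ℂ) • e (σ γ)) (γ : List (Fin n))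
    (v : HTensor (Fock n) H) :
    coord H γ (ampliation (Fock n) H (star A) v) = (c γ : ℂ) • coord H (σ γ) v := by
  refine ext_inner_left ℂ fun y => ?_
  rw [inner_coord_right, map_star, ContinuousLinearMap.star_eq_adjoint,
    ContinuousLinearMap.adjoint_inner_right, ampliation_apply, tensorOp_tensorVec, hA,
    tensorVec_smul, inner_smul_right, inner_coord_right, smul_apply, inner_smul_left,
    Complex.conj_ofReal]
  rfl

end Shift

theorem mono_Lam_e (f : PosRegular n) (m : ℕ) (α γ : List (Fin n)) : mono (Lam f m) α (e γ) =
    ((√(f.b m γ / f.b m (γ ++ α.reverse)) : ℝ) : ℂ) • e (γ ++ α.reverse) := by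
  induction α with
  | nil => simp [mono_nil, div_self (f.b_pos m γ).ne']
  | cons i α ih =>
    rw [mono_cons, mul_apply_eq_comp, ih, map_smul, Lam_e, smul_smul, ← Complex.ofReal_mul,
      ← Real.sqrt_mul (div_nonneg (f.b_nonneg _ _) (f.b_nonneg _ _)),
      div_mul_div_cancel₀ (f.b_pos m _).ne', List.reverse_cons, List.append_assoc]

end Coordinates

/-! ### Submultiplicative sequences -/

theorem exists_tendsto_rpow_of_submultiplicative {u : ℕ → ℝ} (h0 : ∀ k, 0 ≤ u k)
    (hmul : ∀ i j, u (i + j) ≤ u i * u j) :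
    ∃ s, Tendsto (fun k : ℕ => u k ^ (1 / (k : ℝ))) atTop (𝓝 s) := by
  by_cases hz : ∃ k, u k = 0
  · obtain ⟨k, hk⟩ := hz
    refine ⟨0, tendsto_const_nhds.congr' ?_⟩
    filter_upwards [eventually_ge_atTop (k + 1)] with j hj
    obtain ⟨i, rfl⟩ := Nat.exists_eq_add_of_le hj
    have hu : u (k + 1 + i) = 0 :=
      le_antisymm (by simpa [hk, add_assoc] using hmul k (1 + i)) (h0 _)
    rw [hu, Real.zero_rpow (by positivity)]
  push Not at hz
  have hpos : ∀ k, 0 < u k := fun k => (h0 k).lt_of_ne' (hz k)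
  have hadd : Subadditive fun k => Real.log (u k) := fun i j => by
    rw [← Real.log_mul (hz i) (hz j)]
    exact Real.log_le_log (hpos _) (hmul i j)
  have hexp : ∀ k : ℕ, u k ^ (1 / (k : ℝ)) = Real.exp (Real.log (u k) / k) := fun k => by
    rw [Real.rpow_def_of_pos (hpos k), mul_one_div]
  simp only [hexp]
  by_cases hb : BddBelow (Set.range fun k : ℕ => Real.log (u k) / k)
  · exact ⟨_, (Real.continuous_exp.tendsto _).comp (hadd.tendsto_lim hb)⟩
  refine ⟨0, Real.tendsto_exp_atBot.comp (tendsto_atBot.2 fun L => ?_)⟩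
  obtain ⟨_, ⟨k, rfl⟩, hk⟩ := not_bddBelow_iff.1 hb (min L 0)
  have hk0 : k ≠ 0 := by
    rintro rfl
    simp at hk
  filter_upwards [hadd.eventually_div_lt_of_div_lt hk0 (hk.trans_le (min_le_left _ _))]
    with p hp using hp.le

/-! ### Quadratic forms of positive operators -/

section OpForm

open scoped ComplexOrder

variable {H : Type*} [NormedAddCommGroup H] [InnerProductSpace ℂ H]

/-- The quadratic form `h ↦ ⟨h, Y h⟩` of a positive operator `Y`, with values in `[0, ∞]`. -/
def opForm (Y : H →L[ℂ] H) (h : H) : ℝ≥0∞ := ENNReal.ofReal (RCLike.re (inner ℂ h (Y h)))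

theorem nonneg_iff_inner_nonneg {Y : H →L[ℂ] H} : 0 ≤ Y ↔ ∀ x, 0 ≤ inner ℂ x (Y x) := by
  rw [ContinuousLinearMap.nonneg_iff_isPositive]
  refine ⟨fun hY => hY.inner_nonneg_right, fun hY => ?_⟩
  refine (ContinuousLinearMap.isPositive_iff_complex Y).2 fun x => ?_
  obtain ⟨hre, him⟩ := Complex.nonneg_iff.1 (hY x)
  have hsymm : inner ℂ (Y x) x = inner ℂ x (Y x) := by
    rw [← inner_conj_symm, Complex.conj_eq_iff_im.2 him.symm]
  rw [hsymm]
  exact ⟨Complex.ext rfl him, hre⟩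

theorem coe_toReal_opForm {Y : H →L[ℂ] H} (hY : 0 ≤ Y) (x : H) :
    ((opForm Y x).toReal : ℂ) = inner ℂ x (Y x) := by
  obtain ⟨hre, him⟩ := Complex.nonneg_iff.1 (nonneg_iff_inner_nonneg.1 hY x)
  rw [opForm, RCLike.re_eq_complex_re, ENNReal.toReal_ofReal hre]
  exact Complex.ext rfl him

theorem opForm_le_opForm_iff [CompleteSpace H] {Y Z : H →L[ℂ] H} (hY : 0 ≤ Y) (hZ : 0 ≤ Z) :
    opForm Y ≤ opForm Z ↔ Y ≤ Z := by
  rw [← sub_nonneg (a := Z), nonneg_iff_inner_nonneg]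
  refine forall_congr' fun x => ?_
  rw [sub_apply, inner_sub_right, sub_nonneg, ← coe_toReal_opForm hY, ← coe_toReal_opForm hZ,
    Complex.real_le_real]
  exact (ENNReal.toReal_le_toReal ENNReal.ofReal_ne_top ENNReal.ofReal_ne_top).symm

theorem opForm_add {Y Z : H →L[ℂ] H} (hY : 0 ≤ Y) (hZ : 0 ≤ Z) :
    opForm (Y + Z) = opForm Y + opForm Z := by
  rw [ContinuousLinearMap.nonneg_iff_isPositive] at hY hZ
  ext x
  rw [Pi.add_apply, opForm, opForm, opForm, ← ENNReal.ofReal_add (hY.re_inner_nonneg_right x)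
    (hZ.re_inner_nonneg_right x), add_apply, inner_add_right, map_add]

theorem opForm_algebraMap (c : ℝ≥0) (x : H) :
    opForm (algebraMap ℝ (H →L[ℂ] H) c) x = c * ‖x‖ₑ ^ 2 := by
  have hcx : inner ℂ x (algebraMap ℝ (H →L[ℂ] H) c x) = ((c * ‖x‖ ^ 2 : ℝ) : ℂ) := by
    rw [Algebra.algebraMap_eq_smul_one, smul_apply, one_apply_eq_self, ← Complex.coe_smul,
      inner_smul_right, inner_self_eq_norm_sq_to_K]
    push_cast
    rfl
  rw [opForm, hcx, RCLike.re_eq_complex_re, Complex.ofReal_re, ENNReal.ofReal_mul c.coe_nonneg,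
    ENNReal.ofReal_coe_nnreal, enorm_sq_eq_ofReal]

theorem opForm_one (x : H) : opForm (1 : H →L[ℂ] H) x = ‖x‖ₑ ^ 2 := by
  simpa using opForm_algebraMap 1 x

theorem opForm_smul_conj [CompleteSpace H] {a : ℝ} (ha : 0 ≤ a) (A Y : H →L[ℂ] H) (x : H) :
    opForm ((a : ℂ) • (A * Y * star A)) x = ENNReal.ofReal a * opForm Y (star A x) := by
  rw [opForm, opForm, ← ENNReal.ofReal_mul ha, smul_apply, inner_smul_right, mul_apply_eq_comp,
    mul_apply_eq_comp, ← ContinuousLinearMap.adjoint_inner_left]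
  congr 1
  exact Complex.re_ofReal_mul _ _

theorem opForm_le_smul_iff [CompleteSpace H] {Y : H →L[ℂ] H} (hY : 0 ≤ Y) {c : ℝ≥0} :
    (∀ x, opForm Y x ≤ c * ‖x‖ₑ ^ 2) ↔ ‖Y‖ ≤ c := by
  have hc : 0 ≤ algebraMap ℝ (H →L[ℂ] H) c := algebraMap_nonneg _ c.coe_nonneg
  rw [CStarAlgebra.norm_le_iff_le_algebraMap Y c.coe_nonneg hY, ← opForm_le_opForm_iff hY hc,
    Pi.le_def]
  simp only [opForm_algebraMap]

variable {ι : Type*} {u : ι → H →L[ℂ] H} {S : H →L[ℂ] H} [CompleteSpace H]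

theorem HasWOTSum.nonneg (h : HasWOTSum u S) (hu : ∀ i, 0 ≤ u i) : 0 ≤ S :=
  nonneg_iff_inner_nonneg.2 fun x =>
    (hasWOTSum_iff_inner.1 h x x).nonneg fun i => nonneg_iff_inner_nonneg.1 (hu i) x

theorem HasWOTSum.tsum_opForm (h : HasWOTSum u S) (hu : ∀ i, 0 ≤ u i) (x : H) :
    ∑' i, opForm (u i) x = opForm S x := by
  have hre := ((Complex.hasSum_iff _ _).1 (hasWOTSum_iff_inner.1 h x x)).1
  have hnonneg : ∀ i, 0 ≤ (inner ℂ x (u i x)).re := fun i =>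
    (Complex.nonneg_iff.1 (nonneg_iff_inner_nonneg.1 (hu i) x)).1
  exact (ENNReal.ofReal_tsum_of_nonneg hnonneg hre.summable).symm.trans
    (congrArg ENNReal.ofReal hre.tsum_eq)

end OpForm

/-! ### Row bounds and the domain -/

theorem enorm_sqrt_smul_sq {E : Type*} [NormedAddCommGroup E] [NormedSpace ℂ E] {a : ℝ}
    (ha : 0 ≤ a) (v : E) : ‖((√a : ℝ) : ℂ) • v‖ₑ ^ 2 = ENNReal.ofReal a * ‖v‖ₑ ^ 2 := by
  rw [enorm_smul, mul_pow, enorm_sq_eq_ofReal ((√a : ℝ) : ℂ), Complex.norm_real, Real.norm_eq_abs,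
    sq_abs, Real.sq_sqrt ha]

theorem ColumnBound.clm_comp {ι E F G : Type*} [NormedAddCommGroup E] [InnerProductSpace ℂ E]
    [NormedAddCommGroup F] [InnerProductSpace ℂ F] [NormedAddCommGroup G] [InnerProductSpace ℂ G]
    {A : ι → E →L[ℂ] F} {c : ℝ≥0} (hA : ColumnBound A c) (Y : F →L[ℂ] G) :
    ColumnBound (fun i => Y ∘L A i) (‖Y‖₊ * c) := fun x => calc
  ∑' i, ‖Y (A i x)‖ₑ ^ 2 ≤ ∑' i, (‖Y‖ₑ * ‖A i x‖ₑ) ^ 2 :=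
    ENNReal.tsum_le_tsum fun i => by gcongr; exact Y.le_opENorm (A i x)
  _ = ‖Y‖ₑ ^ 2 * ∑' i, ‖A i x‖ₑ ^ 2 := by simp only [mul_pow, ENNReal.tsum_mul_left]
  _ ≤ ‖Y‖ₑ ^ 2 * (c * ‖x‖ₑ) ^ 2 := by gcongr; exact hA x
  _ = ((‖Y‖₊ * c : ℝ≥0) * ‖x‖ₑ) ^ 2 := by rw [ENNReal.coe_mul, ← enorm_eq_nnnorm]; ring

theorem mono_scale {n : ℕ} {H : Type*} [NormedAddCommGroup H] [InnerProductSpace ℂ H] (r : ℝ)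
    (T : Fin n → H →L[ℂ] H) (α : List (Fin n)) :
    mono (scale r T) α = (r : ℂ) ^ α.length • mono T α := by
  induction α with
  | nil => simp [mono_nil]
  | cons i α ih =>
    rw [mono_cons, mono_cons, ih, scale, smul_mul_smul_comm, List.length_cons, pow_succ']

section RowBound

open scoped ComplexOrder

variable {n : ℕ} {H : Type*} [NormedAddCommGroup H] [InnerProductSpace ℂ H] [CompleteSpace H]
  {f : PosRegular n} {m : ℕ} {T : Fin n → H →L[ℂ] H} {c : ℝ≥0}

/-- The operator `√a_α T_α^*`. -/
def rowAdjoint (f : PosRegular n) (T : Fin n → H →L[ℂ] H) (α : List (Fin n)) : H →L[ℂ] H :=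
  (√(f.coeff α) : ℂ) • star (mono T α)

/-- The row `(√a_α T_α)_α` has norm at most `c`; equivalently `Φ_{f,T}(I) ≤ c²`. -/
def RowBound (f : PosRegular n) (T : Fin n → H →L[ℂ] H) (c : ℝ≥0) : Prop :=
  ColumnBound (rowAdjoint f T) c

theorem enorm_rowAdjoint_sq (α : List (Fin n)) (x : H) :
    ‖rowAdjoint f T α x‖ₑ ^ 2 = ENNReal.ofReal (f.coeff α) * ‖star (mono T α) x‖ₑ ^ 2 :=
  enorm_sqrt_smul_sq (f.coeff_nonneg α) _

theorem adjoint_rowAdjoint_comp (Y : H →L[ℂ] H) (α : List (Fin n)) :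
    (rowAdjoint f T α).adjoint ∘L (Y ∘L rowAdjoint f T α) =
      (f.coeff α : ℂ) • (mono T α * Y * star (mono T α)) := by
  have hsq : (√(f.coeff α) : ℂ) * √(f.coeff α) = f.coeff α := by
    exact_mod_cast Real.mul_self_sqrt (f.coeff_nonneg α)
  rw [← ContinuousLinearMap.star_eq_adjoint, rowAdjoint, star_smul, star_star, RCLike.star_def,
    Complex.conj_ofReal, ContinuousLinearMap.smul_comp, ContinuousLinearMap.comp_smul,
    ContinuousLinearMap.comp_smul, smul_smul, hsq]
  rfl

theorem phiTerm_nonneg {Y : H →L[ℂ] H} (hY : 0 ≤ Y) (α : List (Fin n)) :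
    0 ≤ (f.coeff α : ℂ) • (mono T α * Y * star (mono T α)) :=
  smul_nonneg (Complex.zero_le_real.2 (f.coeff_nonneg α)) (star_right_conjugate_nonneg hY _)

namespace RowBound

theorem hasWOTSum_phi (hT : RowBound f T c) (Y : H →L[ℂ] H) :
    HasWOTSum (fun α => (f.coeff α : ℂ) • (mono T α * Y * star (mono T α))) (Phi f T Y) := by
  simp only [Phi, ← adjoint_rowAdjoint_comp]
  exact ((ColumnBound.clm_comp hT Y).hasWOTSum_adjoint_comp hT).wotSummable.hasWOTSum

theorem norm_phi_le (hT : RowBound f T c) (Y : H →L[ℂ] H) : ‖Phi f T Y‖ ≤ c ^ 2 * ‖Y‖ := by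
  simp only [Phi, ← adjoint_rowAdjoint_comp]
  refine ((ColumnBound.clm_comp hT Y).norm_wotSum_adjoint_comp_le hT).trans_eq ?_
  rw [NNReal.coe_mul, coe_nnnorm]
  ring

theorem phi_nonneg (hT : RowBound f T c) {Y : H →L[ℂ] H} (hY : 0 ≤ Y) : 0 ≤ Phi f T Y :=
  (hT.hasWOTSum_phi Y).nonneg (phiTerm_nonneg hY)

theorem iterate_phi_nonneg (hT : RowBound f T c) {Y : H →L[ℂ] H} (hY : 0 ≤ Y) (j : ℕ) :
    0 ≤ (Phi f T)^[j] Y :=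
  Function.Iterate.rec (0 ≤ ·) hY (fun _ => hT.phi_nonneg) j

theorem formMap_opForm (hT : RowBound f T c) {Y : H →L[ℂ] H} (hY : 0 ≤ Y) :
    formMap f T (opForm Y) = opForm (Phi f T Y) := by
  ext x
  rw [← (hT.hasWOTSum_phi Y).tsum_opForm (phiTerm_nonneg hY)]
  exact tsum_congr fun α => (opForm_smul_conj (f.coeff_nonneg α) _ _ x).symm

theorem iterate_formMap_opForm (hT : RowBound f T c) {Y : H →L[ℂ] H} (hY : 0 ≤ Y) (j : ℕ) :
    (formMap f T)^[j] (opForm Y) = opForm ((Phi f T)^[j] Y) := by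
  induction j with
  | zero => rfl
  | succ j ih =>
    rw [Function.iterate_succ_apply', ih, hT.formMap_opForm (hT.iterate_phi_nonneg hY j),
      Function.iterate_succ_apply']

theorem norm_iterate_phi_one_le (hT : RowBound f T c) (j : ℕ) :
    ‖(Phi f T)^[j] 1‖ ≤ (c ^ 2) ^ j := by
  induction j with
  | zero => exact ContinuousLinearMap.norm_id_le.trans_eq (pow_zero _).symm
  | succ j ih =>
    rw [Function.iterate_succ_apply', pow_succ']
    exact (hT.norm_phi_le _).trans (by gcongr)

theorem norm_iterate_phi_one_add_le (hT : RowBound f T c) (i j : ℕ) :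
    ‖(Phi f T)^[i + j] 1‖ ≤ ‖(Phi f T)^[i] 1‖ * ‖(Phi f T)^[j] 1‖ := by
  have hpos : ∀ k, 0 ≤ (Phi f T)^[k] 1 := hT.iterate_phi_nonneg zero_le_one
  have hbound : ∀ k, opForm ((Phi f T)^[k] 1) ≤ (‖(Phi f T)^[k] 1‖₊ : ℝ≥0∞) • opForm 1 :=
    fun k x => by
      rw [Pi.smul_apply, opForm_one]
      exact (opForm_le_smul_iff (hpos k)).2 le_rfl x
  refine (opForm_le_smul_iff (c := ‖(Phi f T)^[i] 1‖₊ * ‖(Phi f T)^[j] 1‖₊) (hpos _)).1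
    fun x => ?_
  rw [Function.iterate_add_apply, ← hT.iterate_formMap_opForm (hpos j)]
  calc (formMap f T)^[i] (opForm ((Phi f T)^[j] 1)) x
      ≤ (formMap f T)^[i] ((‖(Phi f T)^[j] 1‖₊ : ℝ≥0∞) • opForm 1) x :=
        iterate_formMap_mono f T i (hbound j) x
    _ = ‖(Phi f T)^[j] 1‖₊ * opForm ((Phi f T)^[i] 1) x := by
        rw [iterate_formMap_smul, hT.iterate_formMap_opForm zero_le_one, Pi.smul_apply, smul_eq_mul]
    _ ≤ ‖(Phi f T)^[j] 1‖₊ * (‖(Phi f T)^[i] 1‖₊ * ‖x‖ₑ ^ 2) := by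
        gcongr
        exact (hbound i x).trans_eq (by rw [Pi.smul_apply, opForm_one, smul_eq_mul])
    _ = (‖(Phi f T)^[i] 1‖₊ * ‖(Phi f T)^[j] 1‖₊ : ℝ≥0) * ‖x‖ₑ ^ 2 := by
        rw [ENNReal.coe_mul]; ring

theorem exists_hasJointSpectralRadius_le (hT : RowBound f T c) :
    ∃ s ≤ (c : ℝ), HasJointSpectralRadius f T s := by
  obtain ⟨s, hs⟩ := exists_tendsto_rpow_of_submultiplicative
    (fun k => norm_nonneg ((Phi f T)^[k] 1)) hT.norm_iterate_phi_one_add_le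
  have hsqrt : HasJointSpectralRadius f T (s ^ (1 / 2 : ℝ)) := by
    refine (hs.rpow_const (Or.inr (by norm_num))).congr fun k => ?_
    rw [← Real.rpow_mul (norm_nonneg _), one_div_mul_one_div, mul_comm]
  refine ⟨_, le_of_tendsto hsqrt ?_, hsqrt⟩
  filter_upwards [eventually_ge_atTop 1] with k hk
  have hk0 : (k : ℝ) ≠ 0 := by positivity
  calc ‖(Phi f T)^[k] 1‖ ^ (1 / (2 * (k : ℝ)))
      ≤ (((c : ℝ) ^ 2) ^ k) ^ (1 / (2 * (k : ℝ))) := by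
        gcongr; exact hT.norm_iterate_phi_one_le k
    _ = c := by
        rw [← pow_mul, ← Real.rpow_natCast, ← Real.rpow_mul c.coe_nonneg, Nat.cast_mul,
          Nat.cast_two, mul_one_div_cancel (mul_ne_zero two_ne_zero hk0), Real.rpow_one]

theorem isPure (hT : RowBound f T c) (hc : c < 1) : IsPure f T := fun x => by
  have hpow : Tendsto (fun k : ℕ => ((c : ℝ) ^ 2) ^ k) atTop (𝓝 0) :=
    tendsto_pow_atTop_nhds_zero_of_lt_one (by positivity) (pow_lt_one₀ c.2 hc two_ne_zero)
  have hnorm := squeeze_zero_norm hT.norm_iterate_phi_one_le hpow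
  exact ((ContinuousLinearMap.apply ℂ H x).continuous.tendsto' 0 0 (map_zero _)).comp hnorm

end RowBound

theorem IsPure.tendsto_opForm (hT : IsPure f T) (x : H) :
    Tendsto (fun j => opForm ((Phi f T)^[j] 1) x) atTop (𝓝 0) := by
  have hinner : Tendsto (fun j => RCLike.re (inner ℂ x (((Phi f T)^[j] 1) x))) atTop (𝓝 0) :=
    ((RCLike.continuous_re.comp (continuous_const.inner continuous_id)).tendsto' 0 0
      (by simp)).comp (hT x)
  rw [← ENNReal.ofReal_zero]
  exact ENNReal.tendsto_ofReal hinner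

theorem defect_succ (k : ℕ) : defect f T (k + 1) = defect f T k - Phi f T (defect f T k) :=
  Function.iterate_succ_apply' _ _ _

theorem defect_nonneg (hT : T ∈ domain f m H) {k : ℕ} (hk : k ≤ m) : 0 ≤ defect f T k := by
  rcases k.eq_zero_or_pos with rfl | hk0
  · exact zero_le_one
  · exact hT.2 k hk0 hk

theorem rowBound_one_of_mem_domain (hm : 1 ≤ m) (hT : T ∈ domain f m H) : RowBound f T 1 := by
  have hsum : HasWOTSum (fun α => (f.coeff α : ℂ) • (mono T α * 1 * star (mono T α)))
      (Phi f T 1) := WOTSummable.hasWOTSum (by simpa only [mul_one] using hT.1)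
  have hle : Phi f T 1 ≤ 1 := by simpa [defect_succ, defect] using defect_nonneg hT hm
  intro x
  calc ∑' α, ‖rowAdjoint f T α x‖ₑ ^ 2
      = ∑' α, opForm ((f.coeff α : ℂ) • (mono T α * 1 * star (mono T α))) x :=
        tsum_congr fun α => by
          rw [opForm_smul_conj (f.coeff_nonneg α), opForm_one, enorm_rowAdjoint_sq]
    _ = opForm (Phi f T 1) x := hsum.tsum_opForm (phiTerm_nonneg zero_le_one) x
    _ ≤ opForm 1 x := (opForm_le_opForm_iff
        (hsum.nonneg (phiTerm_nonneg zero_le_one)) zero_le_one).2 hle x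
    _ = ((1 : ℝ≥0) * ‖x‖ₑ) ^ 2 := by rw [opForm_one, ENNReal.coe_one, one_mul]

theorem RowBound.scale (hT : RowBound f T c) {r : ℝ≥0} (hr : r ≤ 1) :
    RowBound f (scale r T) (r * c) := fun x => by
  have hterm : ∀ α, ‖rowAdjoint f (NCDomain.scale r T) α x‖ₑ ≤ r * ‖rowAdjoint f T α x‖ₑ := by
    intro α
    rcases eq_or_ne α [] with rfl | hα
    · simp [rowAdjoint, f.coeff_nil]
    · have hrow : rowAdjoint f (NCDomain.scale r T) α =
          (r : ℂ) ^ α.length • rowAdjoint f T α := by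
        rw [rowAdjoint, rowAdjoint, mono_scale, star_smul, smul_comm]
        simp
      rw [hrow, smul_apply, enorm_smul, enorm_pow]
      gcongr
      have hre : ‖((r : ℝ) : ℂ)‖ₑ = r := by simp [enorm_eq_nnnorm]
      rw [hre]
      exact_mod_cast pow_le_of_le_one r.2 hr (List.length_eq_zero_iff.not.2 hα)
  calc ∑' α, ‖rowAdjoint f (NCDomain.scale r T) α x‖ₑ ^ 2
      ≤ ∑' α, (r * ‖rowAdjoint f T α x‖ₑ) ^ 2 := by gcongr; exact hterm _
    _ = r ^ 2 * ∑' α, ‖rowAdjoint f T α x‖ₑ ^ 2 := by simp only [mul_pow, ENNReal.tsum_mul_left]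
    _ ≤ r ^ 2 * (c * ‖x‖ₑ) ^ 2 := by gcongr; exact hT x
    _ = ((r * c : ℝ≥0) * ‖x‖ₑ) ^ 2 := by rw [ENNReal.coe_mul]; ring

theorem enorm_delta_sq (hT : T ∈ domain f m H) (x : H) :
    ‖Delta f m T x‖ₑ ^ 2 = opForm (defect f T m) x := by
  have hΔ := ContinuousLinearMap.nonneg_iff_isPositive _ |>.1 (CFC.sqrt_nonneg (defect f T m))
  have hsq : Delta f m T * Delta f m T = defect f T m :=
    CFC.sqrt_mul_sqrt_self _ (defect_nonneg hT le_rfl)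
  rw [← hsq, opForm, mul_apply_eq_comp, Delta, ← hΔ.inner_left_eq_inner_right,
    inner_self_eq_norm_sq, enorm_sq_eq_ofReal]

theorem tsum_b_mul_enorm_delta_sq (hm : 1 ≤ m) (hT : T ∈ domain f m H) (hpure : IsPure f T)
    (x : H) :
    ∑' α, ENNReal.ofReal (f.b m α) * ‖Delta f m T (star (mono T α) x)‖ₑ ^ 2 = ‖x‖ₑ ^ 2 := by
  have hrow := rowBound_one_of_mem_domain hm hT
  have hstep : ∀ k < m, ∀ j, (formMap f T)^[j] (opForm (defect f T (k + 1))) x +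
      (formMap f T)^[j + 1] (opForm (defect f T k)) x =
      (formMap f T)^[j] (opForm (defect f T k)) x := by
    intro k hk j
    have hsplit : opForm (defect f T (k + 1)) + formMap f T (opForm (defect f T k)) =
        opForm (defect f T k) := by
      rw [hrow.formMap_opForm (defect_nonneg hT hk.le), ← opForm_add (defect_nonneg hT hk)
        (hrow.phi_nonneg (defect_nonneg hT hk.le)), defect_succ, sub_add_cancel]
    rw [Function.iterate_succ_apply, ← Pi.add_apply, ← iterate_formMap_add, hsplit]
  have hlim : Tendsto (fun j => (formMap f T)^[j] (opForm (defect f T 0)) x) atTop (𝓝 0) :=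
    (hpure.tendsto_opForm x).congr fun j =>
      (congrFun (hrow.iterate_formMap_opForm zero_le_one j) x).symm
  simp only [enorm_delta_sq hT, f.b_eq_invOneSubPow hm, tsum_invOneSubPow_mul_form]
  rw [tsum_multichoose_mul_eq (fun k j => (formMap f T)^[j] (opForm (defect f T k)) x) hstep hlim]
  exact opForm_one x

end RowBound

/-! ### The reconstruction operator -/

section Reconstruction

variable {n : ℕ} {H : Type*} [NormedAddCommGroup H] [InnerProductSpace ℂ H] [CompleteSpace H]
  {f : PosRegular n} {m : ℕ} {T : Fin n → H →L[ℂ] H} {c : ℝ≥0}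

theorem coord_tensorOp_one (B : H →L[ℂ] H) (γ : List (Fin n)) (v : HTensor (Fock n) H) :
    coord H γ (tensorOp 1 B v) = B (coord H γ v) := by
  have hone : ∀ α : List (Fin n), (1 : Fock n →L[ℂ] Fock n) (e α) = ((1 : ℝ) : ℂ) • e (id α) :=
    fun α => by simp
  simpa using coord_tensorOp_shift (c := fun _ => 1) Function.injective_id hone B γ v

theorem coord_tensorOp_mono_Lam (α γ : List (Fin n)) (B : H →L[ℂ] H)
    (v : HTensor (Fock n) H) :
    coord H (γ ++ α.reverse) (tensorOp (mono (Lam f m) α) B v) =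
      (√(f.b m γ / f.b m (γ ++ α.reverse)) : ℂ) • B (coord H γ v) :=
  coord_tensorOp_shift (σ := (· ++ α.reverse)) (List.append_left_injective _)
    (mono_Lam_e f m α) B γ v

theorem coord_tensorOp_star_mono_Lam (α γ : List (Fin n)) (v : HTensor (Fock n) H) :
    coord H γ (tensorOp (star (mono (Lam f m) α)) 1 v) =
      (√(f.b m γ / f.b m (γ ++ α.reverse)) : ℂ) • coord H (γ ++ α.reverse) v :=
  coord_ampliation_star (mono_Lam_e f m α) γ v

theorem ColumnBound.tensorOp_one {ι : Type*} {A : ι → H →L[ℂ] H} (hA : ColumnBound A c) :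
    ColumnBound (fun i => tensorOp (1 : Fock n →L[ℂ] Fock n) (A i)) c := fun v => calc
  ∑' i, ‖tensorOp (1 : Fock n →L[ℂ] Fock n) (A i) v‖ₑ ^ 2
      = ∑' γ, ∑' i, ‖A i (coord H γ v)‖ₑ ^ 2 := by
        rw [ENNReal.tsum_comm]
        exact tsum_congr fun i => by simp only [← tsum_enorm_coord_sq, coord_tensorOp_one]
  _ ≤ ∑' γ, (c * ‖coord H γ v‖ₑ) ^ 2 := ENNReal.tsum_le_tsum fun γ => hA _
  _ = (c * ‖v‖ₑ) ^ 2 := by simp only [mul_pow, ENNReal.tsum_mul_left, tsum_enorm_coord_sq]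

theorem ColumnBound.comp_reverse {E G : Type*} [NormedAddCommGroup E] [InnerProductSpace ℂ E]
    [NormedAddCommGroup G] [InnerProductSpace ℂ G] {A : List (Fin n) → E →L[ℂ] G}
    (hA : ColumnBound A c) : ColumnBound (fun α : List (Fin n) => A α.reverse) c := fun x =>
  (tsum_reverse fun α => ‖A α x‖ₑ ^ 2).trans_le (hA x)

/-- The operator `√a_{α~} Λ_α^* ⊗ I`. -/
def creationAdjoint (f : PosRegular n) (m : ℕ) (H : Type*) [NormedAddCommGroup H]
    [InnerProductSpace ℂ H] (α : List (Fin n)) : HTensor (Fock n) H →L[ℂ] HTensor (Fock n) H :=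
  (√(f.coeff α.reverse) : ℂ) • tensorOp (star (mono (Lam f m) α)) 1

theorem columnBound_creationAdjoint (hm : 1 ≤ m) : ColumnBound (creationAdjoint f m H) 1 :=
  fun v => by
  have hterm : ∀ α, ‖creationAdjoint f m H α v‖ₑ ^ 2 =
      ∑' γ, ENNReal.ofReal (f.b m γ * f.coeff α.reverse / f.b m (γ ++ α.reverse)) *
        ‖coord H (γ ++ α.reverse) v‖ₑ ^ 2 := by
    intro α
    rw [creationAdjoint, smul_apply, enorm_sqrt_smul_sq (f.coeff_nonneg _), ← tsum_enorm_coord_sq,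
      ← ENNReal.tsum_mul_left]
    refine tsum_congr fun γ => ?_
    rw [coord_tensorOp_star_mono_Lam, enorm_sqrt_smul_sq (div_nonneg (f.b_nonneg _ _)
      (f.b_nonneg _ _)), ← mul_assoc, ← ENNReal.ofReal_mul (f.coeff_nonneg _), mul_div_assoc',
      mul_comm (f.coeff _)]
  calc ∑' α, ‖creationAdjoint f m H α v‖ₑ ^ 2
      = ∑' γ, ∑' β, ENNReal.ofReal (f.b m γ * f.coeff β / f.b m (γ ++ β)) *
          ‖coord H (γ ++ β) v‖ₑ ^ 2 := by
        rw [ENNReal.tsum_comm, ← tsum_reverse]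
        exact tsum_congr fun β => by rw [hterm, List.reverse_reverse]
    _ = ∑' δ, ENNReal.ofReal (wordMul (f.b m) f.coeff δ / f.b m δ) * ‖coord H δ v‖ₑ ^ 2 := by
        rw [tsum_tsum_eq_tsum_sum_cut]
        refine tsum_congr fun δ => ?_
        simp only [List.take_append_drop, ← Finset.sum_mul, wordMul, Finset.sum_div]
        rw [ENNReal.ofReal_sum_of_nonneg fun i _ => div_nonneg
          (mul_nonneg (f.b_nonneg _ _) (f.coeff_nonneg _)) (f.b_nonneg _ _)]
    _ ≤ ∑' δ, 1 * ‖coord H δ v‖ₑ ^ 2 := by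
        refine ENNReal.tsum_le_tsum fun δ => mul_le_mul_left ?_ _
        exact ENNReal.ofReal_le_one.2 (div_le_one_of_le₀ (f.wordMul_b_coeff_le hm δ)
          (f.b_nonneg _ _))
    _ = ((1 : ℝ≥0) * ‖v‖ₑ) ^ 2 := by
        simp only [one_mul, tsum_enorm_coord_sq, ENNReal.coe_one]

theorem adjoint_creationAdjoint_comp (α : List (Fin n)) :
    (creationAdjoint f m H α).adjoint ∘L tensorOp 1 (rowAdjoint f T α.reverse) =
      resTerm f m T α := by
  have hsq : (√(f.coeff α.reverse) : ℂ) * √(f.coeff α.reverse) = f.coeff α.reverse := by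
    exact_mod_cast Real.mul_self_sqrt (f.coeff_nonneg α.reverse)
  refine HTensor.clm_ext fun x y => ?_
  rw [← ContinuousLinearMap.star_eq_adjoint, creationAdjoint, star_smul, star_tensorOp, star_star,
    star_one, RCLike.star_def, Complex.conj_ofReal, ContinuousLinearMap.comp_apply, smul_apply,
    tensorOp_tensorVec, tensorOp_tensorVec, resTerm, smul_apply, tensorOp_tensorVec, rowAdjoint,
    one_apply_eq_self, one_apply_eq_self, smul_apply, map_smul, smul_smul, hsq]

/-- The reconstruction operator `R_T = ∑_{|α| ≥ 1} a_{α~} Λ_α ⊗ T_{α~}^*`. -/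
def reconstruction (f : PosRegular n) (m : ℕ) (T : Fin n → H →L[ℂ] H) :
    HTensor (Fock n) H →L[ℂ] HTensor (Fock n) H :=
  wotSum (resTerm f m T)

theorem star_resTerm (α : List (Fin n)) : star (resTerm f m T α) = resTermStar f m T α := by
  rw [resTerm, resTermStar, star_smul, star_tensorOp, star_star, RCLike.star_def,
    Complex.conj_ofReal]

namespace RowBound

theorem columnBound_tensorOp (hT : RowBound f T c) :
    ColumnBound (fun α : List (Fin n) =>
      tensorOp (1 : Fock n →L[ℂ] Fock n) (rowAdjoint f T α.reverse)) c :=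
  (ColumnBound.tensorOp_one hT).comp_reverse

theorem hasWOTSum_resTerm (hT : RowBound f T c) (hm : 1 ≤ m) :
    HasWOTSum (resTerm f m T) (reconstruction f m T) := by
  have hsum := hT.columnBound_tensorOp.hasWOTSum_adjoint_comp
    (columnBound_creationAdjoint (f := f) (H := H) hm)
  simp only [adjoint_creationAdjoint_comp] at hsum
  exact hsum.wotSummable.hasWOTSum

theorem norm_reconstruction_le (hT : RowBound f T c) (hm : 1 ≤ m) :
    ‖reconstruction f m T‖ ≤ c := by
  have hle := hT.columnBound_tensorOp.norm_wotSum_adjoint_comp_le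
    (columnBound_creationAdjoint (f := f) (H := H) hm)
  simp only [adjoint_creationAdjoint_comp, NNReal.coe_one, one_mul] at hle
  exact hle

theorem hasWOTSum_resTermStar (hT : RowBound f T c) (hm : 1 ≤ m) :
    HasWOTSum (resTermStar f m T) (star (reconstruction f m T)) := by
  simpa only [star_resTerm] using (hT.hasWOTSum_resTerm hm).star

theorem isUnit_one_sub_reconstruction (hT : RowBound f T c) (hm : 1 ≤ m) (hc : c < 1) :
    IsUnit (1 - reconstruction f m T) :=
  isUnit_one_sub_of_norm_lt_one (R := HTensor (Fock n) H →L[ℂ] HTensor (Fock n) H)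
    ((hT.norm_reconstruction_le hm).trans_lt (by exact_mod_cast hc))

theorem berezinDefined (hT : RowBound f T c) (hm : 1 ≤ m) (hc : c < 1)
    (hdom : T ∈ domain f m H) : BerezinDefined f m T where
  mem_domain := hdom
  radius_lt_one :=
    let ⟨s, hs, hrad⟩ := hT.exists_hasJointSpectralRadius_le
    ⟨s, hs.trans_lt (by exact_mod_cast hc), hrad⟩
  summable := (hT.hasWOTSum_resTerm hm).wotSummable
  summable_star := (hT.hasWOTSum_resTermStar hm).wotSummable
  isUnit := hT.isUnit_one_sub_reconstruction hm hc
  isUnit_star := by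
    rw [(hT.hasWOTSum_resTermStar hm).wotSum_eq, ← star_one, ← star_sub]
    exact (hT.isUnit_one_sub_reconstruction hm hc).star

theorem coord_reconstruction (hT : RowBound f T c) (hm : 1 ≤ m) (δ : List (Fin n))
    (v : HTensor (Fock n) H) :
    coord H δ (reconstruction f m T v) = ∑ i ∈ Finset.range (δ.length + 1),
      (f.coeff (δ.drop i) * √(f.b m (δ.take i) / f.b m δ) : ℂ) •
        star (mono T (δ.drop i)) (coord H (δ.take i) v) := by
  let cut (i : Fin (δ.length + 1)) : List (Fin n) := (δ.drop i).reverse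
  have hcut : Function.Injective cut := fun i j hij => by
    have hlen := congrArg List.length hij
    simp only [cut, List.length_reverse, List.length_drop] at hlen
    omega
  have hcoord : ∀ i, coord H δ (resTerm f m T (cut i) v) =
      (f.coeff (δ.drop i) * √(f.b m (δ.take i) / f.b m δ) : ℂ) •
        star (mono T (δ.drop i)) (coord H (δ.take i) v) := by
    intro i
    have hshift := coord_tensorOp_mono_Lam (f := f) (m := m) (cut i) (δ.take i)
      (star (mono T (δ.drop i))) v
    simp only [cut, List.reverse_reverse, List.take_append_drop] at hshift
    rw [resTerm, smul_apply, map_smul, List.reverse_reverse, hshift, smul_smul]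
  have hzero : ∀ α ∉ Set.range cut, coord H δ (resTerm f m T α v) = 0 := by
    intro α hα
    have hδ : δ ∉ Set.range (· ++ α.reverse) := by
      rintro ⟨γ, rfl⟩
      exact hα ⟨⟨γ.length, by simp⟩, by simp [cut]⟩
    rw [resTerm, smul_apply, map_smul, coord_tensorOp_shift_of_notMem_range
      (mono_Lam_e f m α) _ hδ, smul_zero]
  refine ext_inner_left ℂ fun y => ?_
  have hsum := hasWOTSum_iff_inner.1 (hT.hasWOTSum_resTerm hm) v (tensorVec H (e δ) y)
  simp only [← inner_coord_right] at hsum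
  rw [← hcut.hasSum_iff fun α hα => by rw [hzero α hα, inner_zero_right]] at hsum
  rw [hsum.unique (hasSum_fintype _), inner_sum, Finset.sum_range]
  simp only [Function.comp_apply, hcoord]

end RowBound

end Reconstruction

/-! ### The Berezin kernel -/

section Kernel

variable {n : ℕ} {H : Type*} [NormedAddCommGroup H] [InnerProductSpace ℂ H] [CompleteSpace H]
  {f : PosRegular n} {m : ℕ} {T : Fin n → H →L[ℂ] H} {c : ℝ≥0}

theorem inverse_one_sub_pow_succ {R : Type*} [Ring R] {a : R} (ha : IsUnit (1 - a)) (k : ℕ) :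
    Ring.inverse (1 - a) ^ (k + 1) =
      Ring.inverse (1 - a) ^ k + a * Ring.inverse (1 - a) ^ (k + 1) := by
  rw [← sub_eq_iff_eq_add, ← one_sub_mul, pow_succ', ← mul_assoc, Ring.mul_inverse_cancel _ ha,
    one_mul]

theorem RowBound.coord_inverse_pow_tensorVec (hT : RowBound f T c) (hm : 1 ≤ m) (hc : c < 1)
    (k : ℕ) (x : H) (δ : List (Fin n)) :
    coord H δ ((Ring.inverse (1 - reconstruction f m T) ^ k) (tensorVec H (e []) x)) =
      (invOneSubPow f.coeff k δ / √(f.b m δ) : ℂ) • star (mono T δ) x := by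
  induction k generalizing δ with
  | zero =>
    rw [pow_zero, one_apply_eq_self, coord_tensorVec, invOneSubPow_zero]
    split_ifs with hδ
    · subst hδ
      simp [f.b_nil, mono_nil]
    · simp
  | succ k ih =>
    let v := (Ring.inverse (1 - reconstruction f m T) ^ (k + 1)) (tensorVec H (e []) x)
    have hfix : v = (Ring.inverse (1 - reconstruction f m T) ^ k) (tensorVec H (e []) x) +
        reconstruction f m T v :=
      DFunLike.congr_fun
        (inverse_one_sub_pow_succ (hT.isUnit_one_sub_reconstruction hm hc) k) _
    change coord H δ v = _
    -- `a_[] = 0`, so the coordinate at `δ` only involves those at proper prefixes of `δ`.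
    induction hlen : δ.length using Nat.strong_induction_on generalizing δ with
    | _ N ihN =>
    subst hlen
    have hcut : ∀ i ∈ Finset.range (δ.length + 1),
        (f.coeff (δ.drop i) * √(f.b m (δ.take i) / f.b m δ) : ℂ) •
          star (mono T (δ.drop i)) (coord H (δ.take i) v) =
        (invOneSubPow f.coeff (k + 1) (δ.take i) * f.coeff (δ.drop i) / √(f.b m δ) : ℂ) •
          star (mono T δ) x := by
      intro i hi
      rcases (Finset.mem_range_succ_iff.1 hi).eq_or_lt with rfl | hlt
      · simp [f.coeff_nil]
      have hmono : star (mono T δ) x =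
          star (mono T (δ.drop i)) (star (mono T (δ.take i)) x) := by
        rw [← mul_apply_eq_comp, ← star_mul, ← mono_append, List.take_append_drop]
      have hb : (√(f.b m (δ.take i)) : ℂ) ≠ 0 :=
        Complex.ofReal_ne_zero.2 (Real.sqrt_pos.2 (f.b_pos m _)).ne'
      rw [ihN _ (by rwa [List.length_take_of_le hlt.le]) _ rfl, map_smul, smul_smul, ← hmono,
        Real.sqrt_div (f.b_nonneg _ _), Complex.ofReal_div]
      congr 1
      field_simp
    rw [hfix, map_add, ih, hT.coord_reconstruction hm, Finset.sum_congr rfl hcut,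
      ← Finset.sum_smul, ← add_smul, invOneSubPow_succ f.coeff_nil, wordMul, ← Finset.sum_div,
      ← add_div]
    push_cast
    rfl

/-- The coefficient `√b_α Δ T_α^*` of `e_α` in the Berezin kernel. -/
def kernelCoord (f : PosRegular n) (m : ℕ) (T : Fin n → H →L[ℂ] H) (α : List (Fin n)) :
    H →L[ℂ] H :=
  (√(f.b m α) : ℂ) • (Delta f m T ∘L star (mono T α))

theorem kernelTerm_apply (α : List (Fin n)) (x : H) :
    kernelTerm f m T α x = tensorVec H (e α) (kernelCoord f m T α x) := by
  rw [kernelTerm, kernelCoord, smul_apply, smul_apply, map_smul]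
  rfl

theorem tsum_enorm_kernelCoord_sq (hm : 1 ≤ m) (hT : T ∈ domain f m H) (hpure : IsPure f T)
    (x : H) : ∑' α, ‖kernelCoord f m T α x‖ₑ ^ 2 = ‖x‖ₑ ^ 2 := by
  simp only [← tsum_b_mul_enorm_delta_sq hm hT hpure x, kernelCoord, smul_apply,
    enorm_sqrt_smul_sq (f.b_nonneg m _), ContinuousLinearMap.comp_apply]

theorem columnBound_kernelCoord (hm : 1 ≤ m) (hT : T ∈ domain f m H) (hpure : IsPure f T) :
    ColumnBound (kernelCoord f m T) 1 := fun x => by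
  rw [tsum_enorm_kernelCoord_sq hm hT hpure, ENNReal.coe_one, one_mul]

theorem ColumnBound.hasSum_tensorVec {A : List (Fin n) → H →L[ℂ] H} (hA : ColumnBound A c)
    (x : H) : HasSum (fun α => tensorVec H (e α) (A α x))
      ((isHilbertSum_coordIsometry H).linearIsometryEquiv.symm (hA.op x)) :=
  (isHilbertSum_coordIsometry H).hasSum_linearIsometryEquiv_symm (hA.op x)

theorem kernel_apply (hm : 1 ≤ m) (hT : T ∈ domain f m H) (hpure : IsPure f T) (x : H) :
    kernel f m T x = (isHilbertSum_coordIsometry H).linearIsometryEquiv.symm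
      ((columnBound_kernelCoord hm hT hpure).op x) := by
  let V : lp (fun _ : List (Fin n) => H) 2 →L[ℂ] HTensor (Fock n) H :=
    (isHilbertSum_coordIsometry (n := n) H).linearIsometryEquiv.symm.toContinuousLinearEquiv
  have hsum : HasWOTSum (kernelTerm f m T) (V ∘L (columnBound_kernelCoord hm hT hpure).op) :=
    hasWOTSum_iff_inner.2 fun x y => by
      simp only [kernelTerm_apply]
      exact ((columnBound_kernelCoord hm hT hpure).hasSum_tensorVec x).mapL (innerSL ℂ y)
  rw [kernel, hsum.wotSum_eq]
  rfl

theorem hasSum_kernelTerm (hm : 1 ≤ m) (hT : T ∈ domain f m H) (hpure : IsPure f T) (x : H) :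
    HasSum (fun α => kernelTerm f m T α x) (kernel f m T x) := by
  simpa only [kernel_apply hm hT hpure, kernelTerm_apply] using
    (columnBound_kernelCoord hm hT hpure).hasSum_tensorVec x

theorem coord_kernel (hm : 1 ≤ m) (hT : T ∈ domain f m H) (hpure : IsPure f T)
    (α : List (Fin n)) (x : H) : coord H α (kernel f m T x) = kernelCoord f m T α x := by
  rw [kernel_apply hm hT hpure, coord_linearIsometryEquiv_symm, ColumnBound.op_apply]

theorem norm_kernel_apply (hm : 1 ≤ m) (hT : T ∈ domain f m H) (hpure : IsPure f T) (x : H) :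
    ‖kernel f m T x‖ = ‖x‖ := by
  have hsq : ‖kernel f m T x‖ₑ ^ 2 = ‖x‖ₑ ^ 2 := by
    simp only [← tsum_enorm_coord_sq, coord_kernel hm hT hpure,
      tsum_enorm_kernelCoord_sq hm hT hpure]
  exact enorm_eq_iff_norm_eq.1 ((ENNReal.pow_right_strictMono two_ne_zero).injective hsq)

theorem ampliation_star_W_comp_kernel (hm : 1 ≤ m) (hT : T ∈ domain f m H) (hpure : IsPure f T)
    (i : Fin n) :
    ampliation (Fock n) H (star (W f m i)) ∘L kernel f m T = kernel f m T ∘L star (T i) := by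
  ext x
  refine coord_ext fun γ => ?_
  rw [ContinuousLinearMap.comp_apply, ContinuousLinearMap.comp_apply,
    coord_ampliation_star (W_e f m i), coord_kernel hm hT hpure, coord_kernel hm hT hpure,
    kernelCoord, kernelCoord, smul_apply, smul_apply, smul_smul, ← Complex.ofReal_mul,
    Real.sqrt_div (f.b_nonneg _ _), div_mul_cancel₀ _ (Real.sqrt_pos.2 (f.b_pos m _)).ne',
    mono_cons, star_mul]
  rfl

namespace RowBound

theorem kernel_eq (hT : RowBound f T c) (hm : 1 ≤ m) (hc : c < 1) (hdom : T ∈ domain f m H) :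
    kernel f m T = (tensorOp 1 (Delta f m T) *
      Ring.inverse (1 - reconstruction f m T) ^ m) ∘L tensorVec H (e []) := by
  ext x
  refine coord_ext fun δ => ?_
  rw [coord_kernel hm hdom (hT.isPure hc), ContinuousLinearMap.comp_apply, mul_apply_eq_comp,
    coord_tensorOp_one, hT.coord_inverse_pow_tensorVec hm hc, ← f.b_eq_invOneSubPow hm,
    ← Complex.ofReal_div, Real.div_sqrt, map_smul]
  rfl

theorem berezin_eq_extBerezin (hT : RowBound f T c) (hm : 1 ≤ m) (hc : c < 1)
    (hdom : T ∈ domain f m H) : berezin f m T = extBerezin f m T := by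
  ext1 g
  have hdelta : star (Delta f m T) = Delta f m T := (CFC.sqrt_nonneg (defect f T m)).star_eq
  have hsplit : tensorOp g (Delta f m T ^ 2) =
      star (tensorOp 1 (Delta f m T)) * (tensorOp g 1 * tensorOp 1 (Delta f m T)) := by
    rw [star_tensorOp, star_one, hdelta]
    simp only [← tensorOp_mul, one_mul, mul_one, sq]
  have hstar : Ring.inverse (1 - wotSum (resTermStar f m T)) =
      star (Ring.inverse (1 - reconstruction f m T)) := by
    rw [(hT.hasWOTSum_resTermStar hm).wotSum_eq,
      ← Ring.inverse_star (R := HTensor (Fock n) H →L[ℂ] HTensor (Fock n) H), star_sub, star_one]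
  rw [berezin, extBerezin, hT.kernel_eq hm hc hdom, hsplit, hstar, ← star_pow,
    ContinuousLinearMap.adjoint_comp, ← ContinuousLinearMap.star_eq_adjoint (_ * _), star_mul]
  rfl

end RowBound

end Kernel

/-! ### Compressions and complete contractivity -/

section Compression

variable {G H : Type*} [NormedAddCommGroup G] [InnerProductSpace ℂ G] [CompleteSpace G]
  [NormedAddCommGroup H] [InnerProductSpace ℂ H] [CompleteSpace H]

/-- The compression `A ↦ K^* A K` of operators along `K`. -/
def compression (K : H →L[ℂ] G) : (G →L[ℂ] G) →ₗ[ℂ] (H →L[ℂ] H) where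
  toFun A := K.adjoint ∘L A ∘L K
  map_add' A B := by rw [ContinuousLinearMap.add_comp, ContinuousLinearMap.comp_add]
  map_smul' c A := by
    rw [ContinuousLinearMap.smul_comp, ContinuousLinearMap.comp_smul, RingHom.id_apply]

theorem compression_apply (K : H →L[ℂ] G) (A : G →L[ℂ] G) :
    compression K A = K.adjoint ∘L A ∘L K := rfl

variable {K : H →L[ℂ] G}

theorem norm_adjoint_apply_le (hK : ∀ x, ‖K x‖ = ‖x‖) (y : G) : ‖K.adjoint y‖ ≤ ‖y‖ := by
  have hnorm : ‖K‖ ≤ 1 := K.opNorm_le_bound zero_le_one fun x => by rw [hK, one_mul]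
  refine K.adjoint.le_of_opNorm_le_of_le ?_ le_rfl |>.trans_eq (one_mul _)
  rwa [LinearIsometryEquiv.norm_map]

end Compression

section OpMatrix

variable {E : Type*} [NormedAddCommGroup E] [InnerProductSpace ℂ E] {k : ℕ}

theorem opMatrix_apply (x : Matrix (Fin k) (Fin k) (E →L[ℂ] E))
    (v : PiLp 2 (fun _ : Fin k => E)) (i : Fin k) : opMatrix x v i = ∑ j, x i j (v j) := by
  simp [opMatrix]

theorem opMatrix_mul (x y : Matrix (Fin k) (Fin k) (E →L[ℂ] E)) :
    opMatrix (x * y) = opMatrix x * opMatrix y := by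
  ext v i
  simp only [mul_apply_eq_comp, opMatrix_apply, Matrix.mul_apply, sum_apply, map_sum]
  exact Finset.sum_comm

theorem opMatrix_injective :
    Function.Injective (opMatrix : Matrix (Fin k) (Fin k) (E →L[ℂ] E) → _) := by
  intro x y h
  ext i j v
  simpa [opMatrix_apply, apply_ite] using congrArg (fun A => A (PiLp.single 2 j v) i) h

variable [CompleteSpace E]

theorem opMatrix_conjTranspose (x : Matrix (Fin k) (Fin k) (E →L[ℂ] E)) :
    opMatrix x.conjTranspose = star (opMatrix x) := by
  rw [ContinuousLinearMap.star_eq_adjoint, ContinuousLinearMap.eq_adjoint_iff]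
  intro v w
  simp only [PiLp.inner_apply, opMatrix_apply, Matrix.conjTranspose_apply, sum_inner, inner_sum,
    ContinuousLinearMap.star_eq_adjoint, ContinuousLinearMap.adjoint_inner_left]
  exact Finset.sum_comm

/-- Operator matrices as a faithful representation on `E^{(k)}` of the C⋆-algebra of matrices over
`B(E)`. -/
def opMatrixHom (E : Type*) [NormedAddCommGroup E] [InnerProductSpace ℂ E] [CompleteSpace E]
    (k : ℕ) : CStarMatrix (Fin k) (Fin k) (E →L[ℂ] E) →⋆ₙₐ[ℂ]
      (PiLp 2 (fun _ : Fin k => E) →L[ℂ] PiLp 2 (fun _ : Fin k => E)) where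
  toFun x := opMatrix (CStarMatrix.ofMatrix.symm x)
  map_smul' c x := by
    ext v i
    simp [opMatrix_apply, Finset.smul_sum]
  map_zero' := by
    ext v i
    simp [opMatrix_apply]
  map_add' x y := by
    ext v i
    simp [opMatrix_apply, Finset.sum_add_distrib]
  map_mul' := opMatrix_mul
  map_star' := opMatrix_conjTranspose

theorem norm_opMatrix_eq (x : CStarMatrix (Fin k) (Fin k) (E →L[ℂ] E)) :
    ‖opMatrix (CStarMatrix.ofMatrix.symm x)‖ = ‖x‖ :=
  NonUnitalStarAlgHom.norm_map (A := CStarMatrix (Fin k) (Fin k) (E →L[ℂ] E)) (opMatrixHom E k)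
    opMatrix_injective x

theorem continuous_opMatrix :
    Continuous (opMatrix : Matrix (Fin k) (Fin k) (E →L[ℂ] E) → _) :=
  map_continuous (opMatrixHom E k)

theorem norm_opMatrix_map_le {F : Type*} [NormedAddCommGroup F] [InnerProductSpace ℂ F]
    [CompleteSpace F] (π : (E →L[ℂ] E) →⋆ₐ[ℂ] (F →L[ℂ] F))
    (x : Matrix (Fin k) (Fin k) (E →L[ℂ] E)) :
    ‖opMatrix fun i j => π (x i j)‖ ≤ ‖opMatrix x‖ := by
  let x' : CStarMatrix (Fin k) (Fin k) (E →L[ℂ] E) := CStarMatrix.ofMatrix x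
  calc ‖opMatrix fun i j => π (x i j)‖ = ‖CStarMatrix.mapₙₐ (π : _ →⋆ₙₐ[ℂ] (F →L[ℂ] F)) x'‖ :=
        norm_opMatrix_eq _
    _ ≤ ‖x'‖ := NonUnitalStarAlgHom.norm_apply_le _ x'
    _ = ‖opMatrix x‖ := (norm_opMatrix_eq x').symm

theorem norm_opMatrix_compression_le {H : Type*} [NormedAddCommGroup H] [InnerProductSpace ℂ H]
    [CompleteSpace H] {K : H →L[ℂ] E} (hK : ∀ x, ‖K x‖ = ‖x‖)
    (x : Matrix (Fin k) (Fin k) (E →L[ℂ] E)) :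
    ‖opMatrix fun i j => compression K (x i j)‖ ≤ ‖opMatrix x‖ := by
  refine ContinuousLinearMap.opNorm_le_bound _ (norm_nonneg _) fun v => ?_
  let w : PiLp 2 (fun _ : Fin k => E) := WithLp.toLp 2 fun j => K (v j)
  have hw : ‖w‖ = ‖v‖ := by simp only [PiLp.norm_eq_of_L2, w, hK]
  have hcoord : ∀ i, opMatrix (fun i j => compression K (x i j)) v i =
      K.adjoint (opMatrix x w i) := fun i => by
    rw [opMatrix_apply x, map_sum]
    exact opMatrix_apply _ v i
  rw [← hw]
  refine le_trans ?_ ((opMatrix x).le_opNorm w)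
  simp only [PiLp.norm_eq_of_L2, hcoord]
  gcongr
  exact norm_adjoint_apply_le hK _

end OpMatrix

section CompletelyContractive

variable {E H : Type*} [NormedAddCommGroup E] [InnerProductSpace ℂ E]
  [NormedAddCommGroup H] [InnerProductSpace ℂ H] {X : Submodule ℂ (E →L[ℂ] E)}

theorem CompletelyContractive.comp_inclusion {X' : Submodule ℂ (E →L[ℂ] E)}
    {u : X →ₗ[ℂ] (H →L[ℂ] H)} (hu : CompletelyContractive u) (hX : X' ≤ X) :
    CompletelyContractive (u ∘ₗ Submodule.inclusion hX) :=
  fun k x => hu k fun i j => Submodule.inclusion hX (x i j)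

variable [CompleteSpace H]

theorem completelyContractive_of_tendsto {ι : Type*} {l : Filter ι} [l.NeBot]
    {u : ι → X →ₗ[ℂ] (H →L[ℂ] H)} {v : X →ₗ[ℂ] (H →L[ℂ] H)}
    (hu : ∀ᶠ i in l, CompletelyContractive (u i))
    (hv : ∀ g, Tendsto (fun i => u i g) l (𝓝 (v g))) : CompletelyContractive v := by
  intro k x
  have hlim : Tendsto (fun a => opMatrix fun i j => u a (x i j)) l
      (𝓝 (opMatrix fun i j => v (x i j))) :=
    (continuous_opMatrix.tendsto _).comp
      (tendsto_pi_nhds.2 fun i => tendsto_pi_nhds.2 fun j => hv (x i j))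
  exact le_of_tendsto hlim.norm (hu.mono fun a ha => ha k x)

theorem completelyContractive_compression [CompleteSpace E] {G : Type*} [NormedAddCommGroup G]
    [InnerProductSpace ℂ G] [CompleteSpace G] (π : (E →L[ℂ] E) →⋆ₐ[ℂ] (G →L[ℂ] G))
    {K : H →L[ℂ] G} (hK : ∀ x, ‖K x‖ = ‖x‖) (X : Submodule ℂ (E →L[ℂ] E)) :
    CompletelyContractive ((compression K ∘ₗ π.toAlgHom.toLinearMap).domRestrict X) :=
  fun _ x => (norm_opMatrix_compression_le hK fun i j => π (x i j)).trans
    (norm_opMatrix_map_le π fun i j => x i j)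

end CompletelyContractive

/-! ### Dilations -/

section Dilation

variable {A G H : Type*} [CStarAlgebra A]
  [NormedAddCommGroup G] [InnerProductSpace ℂ G] [CompleteSpace G]
  [NormedAddCommGroup H] [InnerProductSpace ℂ H] [CompleteSpace H]
  {n : ℕ} {π : A →⋆ₐ[ℂ] (G →L[ℂ] G)} {w : Fin n → A} {T : Fin n → H →L[ℂ] H} {K : H →L[ℂ] G}

/-- The isometry `K` exhibits `T` as a compression of the tuple `π(w)` to the range of `K`, which is
invariant under the adjoints `π(w_i)^*`. -/
structure IsDilation (π : A →⋆ₐ[ℂ] (G →L[ℂ] G)) (w : Fin n → A) (T : Fin n → H →L[ℂ] H)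
    (K : H →L[ℂ] G) : Prop where
  norm_map : ∀ x, ‖K x‖ = ‖x‖
  intertwine : ∀ i, π (star (w i)) ∘L K = K ∘L star (T i)

theorem compression_mul_of_intertwine {g : A} {s : H →L[ℂ] H}
    (hg : π (star g) ∘L K = K ∘L star s) (h : A) :
    compression K (π (g * h)) = s * compression K (π h) := by
  have hadj : K.adjoint ∘L π g = s ∘L K.adjoint := by
    simpa [ContinuousLinearMap.adjoint_comp, map_star, ContinuousLinearMap.star_eq_adjoint]
      using congrArg ContinuousLinearMap.adjoint hg
  rw [compression_apply, map_mul, ContinuousLinearMap.mul_def, ← ContinuousLinearMap.comp_assoc,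
    ← ContinuousLinearMap.comp_assoc, hadj]
  rfl

theorem norm_compression_le (hK : ∀ x, ‖K x‖ = ‖x‖) (g : A) : ‖compression K (π g)‖ ≤ ‖g‖ := by
  refine ContinuousLinearMap.opNorm_le_bound _ (norm_nonneg _) fun x => ?_
  calc ‖K.adjoint (π g (K x))‖ ≤ ‖π g (K x)‖ := norm_adjoint_apply_le hK _
    _ ≤ ‖g‖ * ‖K x‖ := (π g).le_of_opNorm_le (NonUnitalStarAlgHom.norm_apply_le π g) _
    _ = ‖g‖ * ‖x‖ := by rw [hK]

/-- The elements `g` such that the range of `K` is invariant under `π(g)^*`. -/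
def coinvariantAlgebra (π : A →⋆ₐ[ℂ] (G →L[ℂ] G)) (K : H →L[ℂ] G) : Subalgebra ℂ A where
  carrier := {g | ∀ x, π (star g) (K x) ∈ K.range}
  mul_mem' {g h} hg hh x := by
    obtain ⟨y, hy⟩ := hg x
    rw [star_mul, map_mul, mul_apply_eq_comp, ← hy]
    exact hh y
  add_mem' hg hh x := by
    rw [star_add, map_add, add_apply]
    exact add_mem (hg x) (hh x)
  algebraMap_mem' c x := by
    rw [← algebraMap_star_comm, AlgHomClass.commutes, ContinuousLinearMap.algebraMap_apply]
    exact Submodule.smul_mem _ _ ⟨x, rfl⟩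

namespace IsDilation

theorem adjoint_comp_self (hK : IsDilation π w T K) : K.adjoint ∘L K = 1 :=
  (ContinuousLinearMap.norm_map_iff_adjoint_comp_self K).1 hK.norm_map

theorem compression_one (hK : IsDilation π w T K) : compression K (π 1) = 1 := by
  rw [map_one]
  exact hK.adjoint_comp_self

theorem intertwine_mono (hK : IsDilation π w T K) (α : List (Fin n)) :
    π (star (mono w α)) ∘L K = K ∘L star (mono T α) := by
  induction α with
  | nil => simp only [mono_nil, star_one, map_one]; rfl
  | cons i α ih =>
    rw [mono_cons, mono_cons, star_mul, star_mul, map_mul, ContinuousLinearMap.mul_def,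
      ContinuousLinearMap.comp_assoc, hK.intertwine, ← ContinuousLinearMap.comp_assoc, ih,
      ContinuousLinearMap.mul_def, ContinuousLinearMap.comp_assoc]

theorem compression_mono (hK : IsDilation π w T K) (α β : List (Fin n)) :
    compression K (π (mono w α * star (mono w β))) = mono T α * star (mono T β) := by
  rw [compression_mul_of_intertwine (hK.intertwine_mono α), compression_apply,
    hK.intertwine_mono, ← ContinuousLinearMap.comp_assoc, hK.adjoint_comp_self]
  rfl

theorem adjoin_closure_le_coinvariantAlgebra (hK : IsDilation π w T K) :
    (Algebra.adjoin ℂ (Set.range w)).topologicalClosure ≤ coinvariantAlgebra π K := by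
  have hrange : IsClosed (Set.range K) :=
    (AddMonoidHomClass.isometry_of_norm K hK.norm_map).isClosedEmbedding.isClosed_range
  have hπ : Continuous π := AddMonoidHomClass.continuous_of_bound π 1 fun g => by
    rw [one_mul]
    exact NonUnitalStarAlgHom.norm_apply_le π g
  refine Subalgebra.topologicalClosure_minimal (Algebra.adjoin_le ?_) ?_
  · rintro _ ⟨i, rfl⟩ x
    exact ⟨star (T i) x, (congrArg (· x) (hK.intertwine i)).symm⟩
  · have hinter : (coinvariantAlgebra π K : Set A) =
        ⋂ x, {g | π (star g) (K x) ∈ Set.range K} := by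
      ext g
      rw [Set.mem_iInter]
      rfl
    rw [hinter]
    exact isClosed_iInter fun x => hrange.preimage
      ((hπ.comp continuous_star).clm_apply continuous_const)

theorem compression_mul (hK : IsDilation π w T K) {g : A}
    (hg : g ∈ (Algebra.adjoin ℂ (Set.range w)).topologicalClosure) (h : A) :
    compression K (π (g * h)) = compression K (π g) * compression K (π h) := by
  refine compression_mul_of_intertwine ?_ h
  ext x
  obtain ⟨y, hy⟩ := hK.adjoin_closure_le_coinvariantAlgebra hg x
  have hretract : K.adjoint (K y) = y := congrArg (· y) hK.adjoint_comp_self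
  have hstar : star (compression K (π g)) = compression K (π (star g)) := by
    rw [ContinuousLinearMap.star_eq_adjoint, compression_apply, compression_apply, map_star,
      ContinuousLinearMap.adjoint_comp, ContinuousLinearMap.adjoint_comp,
      ContinuousLinearMap.adjoint_adjoint, ContinuousLinearMap.star_eq_adjoint]
    rfl
  rw [hstar, compression_apply]
  simp only [ContinuousLinearMap.comp_apply]
  rw [← hy, ContinuousLinearMap.coe_coe, hretract]

end IsDilation

end Dilation

/-! ### Limits of dilated tuples -/

section Limits

variable {ι A B : Type*} [NormedAddCommGroup A] [NormedSpace ℂ A] [NormedAddCommGroup B]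
  [NormedSpace ℂ B] {l : Filter ι}

theorem tendsto_zero_of_mem_closure_span {u : ι → A →ₗ[ℂ] B} {C : ℝ} (hC : 0 < C)
    (hu : ∀ᶠ i in l, ∀ g, ‖u i g‖ ≤ C * ‖g‖) {s : Set A}
    (hs : ∀ g ∈ s, Tendsto (fun i => u i g) l (𝓝 0)) {g : A}
    (hg : g ∈ (Submodule.span ℂ s).topologicalClosure) : Tendsto (fun i => u i g) l (𝓝 0) := by
  have hspan : ∀ g ∈ Submodule.span ℂ s, Tendsto (fun i => u i g) l (𝓝 0) := fun g hg => by
    induction hg using Submodule.span_induction with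
    | mem g hg => exact hs g hg
    | zero => simpa using tendsto_const_nhds
    | add g g' _ _ h h' => simpa using h.add h'
    | smul c g _ h => simpa using h.const_smul c
  refine Metric.tendsto_nhds.2 fun ε hε => ?_
  obtain ⟨g', hg', hdist⟩ := Metric.mem_closure_iff.1 hg (ε / (2 * C)) (by positivity)
  filter_upwards [hu, Metric.tendsto_nhds.1 (hspan g' hg') (ε / 2) (half_pos hε)] with i hi hi'
  rw [dist_zero_right] at hi' ⊢
  calc ‖u i g‖ = ‖u i (g - g') + u i g'‖ := by rw [map_sub, sub_add_cancel]
    _ ≤ C * ‖g - g'‖ + ‖u i g'‖ := (norm_add_le _ _).trans (by gcongr; exact hi _)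
    _ < C * (ε / (2 * C)) + ε / 2 := by
        rw [← dist_eq_norm]
        gcongr
    _ = ε := by field_simp; ring

theorem tendsto_of_mem_closure_span {u : ι → A →ₗ[ℂ] B} {v : A →ₗ[ℂ] B}
    (hu : ∀ᶠ i in l, ∀ g, ‖u i g‖ ≤ ‖g‖) (hv : ∀ g, ‖v g‖ ≤ ‖g‖) {s : Set A}
    (hs : ∀ g ∈ s, Tendsto (fun i => u i g) l (𝓝 (v g))) {g : A}
    (hg : g ∈ (Submodule.span ℂ s).topologicalClosure) :
    Tendsto (fun i => u i g) l (𝓝 (v g)) := by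
  rw [← tendsto_sub_nhds_zero_iff]
  refine tendsto_zero_of_mem_closure_span (u := fun i => u i - v) two_pos ?_
    (fun g' hg' => tendsto_sub_nhds_zero_iff.2 (hs g' hg')) hg
  filter_upwards [hu] with i hi g'
  exact (norm_sub_le _ _).trans (by linarith [hi g', hv g'])

theorem exists_tendsto_of_mem_closure_span [CompleteSpace B] [l.NeBot] {u : ι → A →ₗ[ℂ] B}
    (hu : ∀ᶠ i in l, ∀ g, ‖u i g‖ ≤ ‖g‖) {s : Set A}
    (hs : ∀ g ∈ s, ∃ b, Tendsto (fun i => u i g) l (𝓝 b)) {g : A}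
    (hg : g ∈ (Submodule.span ℂ s).topologicalClosure) :
    ∃ b, Tendsto (fun i => u i g) l (𝓝 b) := by
  have hdiff : Tendsto (fun p : ι × ι => (u p.1 - u p.2) g) (l ×ˢ l) (𝓝 0) := by
    refine tendsto_zero_of_mem_closure_span two_pos ?_ (fun g' hg' => ?_) hg
    · filter_upwards [hu.prod_mk hu] with p hp g'
      exact (norm_sub_le _ _).trans (by linarith [hp.1 g', hp.2 g'])
    · obtain ⟨b, hb⟩ := hs g' hg'
      simpa using! (hb.comp tendsto_fst).sub (hb.comp (tendsto_snd (f := l)))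
  refine CompleteSpace.complete (cauchy_map_iff.2 ⟨inferInstance, ?_⟩)
  rw [uniformity_eq_comap_nhds_zero_swapped, tendsto_comap_iff]
  exact hdiff

theorem exists_linearMap_tendsto {V : Submodule ℂ A} {u : ι → A →ₗ[ℂ] B} [l.NeBot]
    (hu : ∀ g ∈ V, ∃ b, Tendsto (fun i => u i g) l (𝓝 b)) :
    ∃ v : V →ₗ[ℂ] B, ∀ g : V, Tendsto (fun i => u i g) l (𝓝 (v g)) := by
  choose v hv using fun g : V => hu g g.2
  exact ⟨linearMapOfTendsto v (fun i => (u i).domRestrict V) (tendsto_pi_nhds.2 hv), hv⟩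

end Limits

section DilationLimits

variable {ι A G H : Type*} [CStarAlgebra A]
  [NormedAddCommGroup G] [InnerProductSpace ℂ G] [CompleteSpace G]
  [NormedAddCommGroup H] [InnerProductSpace ℂ H] [CompleteSpace H]
  {l : Filter ι} {n : ℕ} {π : A →⋆ₐ[ℂ] (G →L[ℂ] G)} {w : Fin n → A}
  {S : ι → Fin n → H →L[ℂ] H} {T : Fin n → H →L[ℂ] H} {K : ι → H →L[ℂ] G}

theorem tendsto_mono {M : Type*} [Monoid M] [TopologicalSpace M] [ContinuousMul M]
    {s : ι → Fin n → M} {t : Fin n → M} (hs : ∀ j, Tendsto (fun i => s i j) l (𝓝 (t j)))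
    (α : List (Fin n)) : Tendsto (fun i => mono (s i) α) l (𝓝 (mono t α)) :=
  tendsto_list_prod α fun j _ => hs j

theorem tendsto_compression_mono (hK : ∀ᶠ i in l, IsDilation π w (S i) (K i))
    (hS : ∀ j, Tendsto (fun i => S i j) l (𝓝 (T j))) (α β : List (Fin n)) :
    Tendsto (fun i => compression (K i) (π (mono w α * star (mono w β)))) l
      (𝓝 (mono T α * star (mono T β))) :=
  ((tendsto_mono hS α).mul (tendsto_mono hS β).star).congr' <|
    hK.mono fun _ hi => (hi.compression_mono α β).symm

/-- The norm closed span of the elements `w_α w_β^*`; for `w = W f m` it is `opSystem f m`. -/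
def wordSystem (w : Fin n → A) : Submodule ℂ A :=
  (Submodule.span ℂ (Set.range fun p : List (Fin n) × List (Fin n) =>
    mono w p.1 * star (mono w p.2))).topologicalClosure

theorem tendsto_compression_of_isDilation (hK : ∀ᶠ i in l, IsDilation π w (S i) (K i))
    (hS : ∀ j, Tendsto (fun i => S i j) l (𝓝 (T j))) {L : H →L[ℂ] G} (hL : IsDilation π w T L)
    {g : A} (hg : g ∈ wordSystem w) :
    Tendsto (fun i => compression (K i) (π g)) l (𝓝 (compression L (π g))) := by
  refine tendsto_of_mem_closure_span (u := fun i => compression (K i) ∘ₗ π.toAlgHom.toLinearMap)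
    (v := compression L ∘ₗ π.toAlgHom.toLinearMap)
    (hK.mono fun _ hi => norm_compression_le hi.norm_map) (norm_compression_le hL.norm_map) ?_ hg
  rintro _ ⟨⟨α, β⟩, rfl⟩
  exact (hL.compression_mono α β).symm ▸ tendsto_compression_mono hK hS α β

variable [l.NeBot]

theorem exists_tendsto_compression (hK : ∀ᶠ i in l, IsDilation π w (S i) (K i))
    (hS : ∀ j, Tendsto (fun i => S i j) l (𝓝 (T j))) {g : A} (hg : g ∈ wordSystem w) :
    ∃ b, Tendsto (fun i => compression (K i) (π g)) l (𝓝 b) := by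
  refine exists_tendsto_of_mem_closure_span
    (u := fun i => compression (K i) ∘ₗ π.toAlgHom.toLinearMap)
    (hK.mono fun _ hi => norm_compression_le hi.norm_map) ?_ hg
  rintro _ ⟨⟨α, β⟩, rfl⟩
  exact ⟨_, tendsto_compression_mono hK hS α β⟩

theorem exists_algHom_of_tendsto_compression (hK : ∀ᶠ i in l, IsDilation π w (S i) (K i))
    {B : Subalgebra ℂ A} (hB : B ≤ (Algebra.adjoin ℂ (Set.range w)).topologicalClosure)
    {v : B →ₗ[ℂ] (H →L[ℂ] H)}
    (hv : ∀ g : B, Tendsto (fun i => compression (K i) (π g)) l (𝓝 (v g))) :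
    ∃ φ : B →ₐ[ℂ] (H →L[ℂ] H), ∀ g, φ g = v g := by
  have hone : v 1 = 1 := tendsto_nhds_unique (hv 1) <| tendsto_const_nhds.congr' <|
    hK.mono fun _ hi => hi.compression_one.symm
  have hmul : ∀ g h, v (g * h) = v g * v h := fun g h =>
    tendsto_nhds_unique (hv (g * h)) <| ((hv g).mul (hv h)).congr' <|
      hK.mono fun _ hi => (hi.compression_mul (hB g.2) h).symm
  exact ⟨AlgHom.ofLinearMap v hone hmul, fun _ => rfl⟩

end DilationLimits

section Radial

variable {n m : ℕ} {H : Type*} [NormedAddCommGroup H] [InnerProductSpace ℂ H]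
  {f : PosRegular n} {T : Fin n → H →L[ℂ] H}

theorem tendsto_scale_one (T : Fin n → H →L[ℂ] H) (i : Fin n) :
    Tendsto (fun r : ℝ => scale r T i) (𝓝[<] 1) (𝓝 (T i)) := by
  have hcont : Continuous fun r : ℝ => scale r T i :=
    Complex.continuous_ofReal.smul continuous_const
  simpa [scale] using (hcont.tendsto 1).mono_left nhdsWithin_le_nhds

variable [CompleteSpace H]

/-- The extended Berezin transform as a linear map. -/
def extBerezinLin (f : PosRegular n) (m : ℕ) (T : Fin n → H →L[ℂ] H) :
    (Fock n →L[ℂ] Fock n) →ₗ[ℂ] (H →L[ℂ] H) :=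
  compression (kernel f m T) ∘ₗ (ampliation (Fock n) H).toAlgHom.toLinearMap

theorem isDilation_kernel (hm : 1 ≤ m) (hT : T ∈ domain f m H) (hpure : IsPure f T) :
    IsDilation (ampliation (Fock n) H) (W f m) T (kernel f m T) where
  norm_map := norm_kernel_apply hm hT hpure
  intertwine := ampliation_star_W_comp_kernel hm hT hpure

namespace HasRadialProperty

theorem eventually_scale (hT : HasRadialProperty f m T) (hm : 1 ≤ m) :
    ∀ᶠ r : ℝ in 𝓝[<] 1,
      scale r T ∈ domain f m H ∧ ∃ c : ℝ≥0, c < 1 ∧ RowBound f (scale r T) c := by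
  obtain ⟨hdom, δ, hδ, hδ1, hscale⟩ := hT
  filter_upwards [Ioo_mem_nhdsLT hδ1] with r ⟨hδr, hr⟩
  lift r to ℝ≥0 using (hδ.trans hδr).le
  have hbound := (rowBound_one_of_mem_domain hm hdom).scale (r := r) (by exact_mod_cast hr.le)
  exact ⟨hscale r hδr hr, r, by exact_mod_cast hr, by simpa using hbound⟩

theorem eventually_berezinDefined (hT : HasRadialProperty f m T) (hm : 1 ≤ m) :
    ∀ᶠ r : ℝ in 𝓝[<] 1, BerezinDefined f m (scale r T) :=
  (hT.eventually_scale hm).mono fun _ ⟨hdom, _, hc, hr⟩ => hr.berezinDefined hm hc hdom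

theorem eventually_isDilation_kernel (hT : HasRadialProperty f m T) (hm : 1 ≤ m) :
    ∀ᶠ r : ℝ in 𝓝[<] 1,
      IsDilation (ampliation (Fock n) H) (W f m) (scale r T) (kernel f m (scale r T)) :=
  (hT.eventually_scale hm).mono fun _ ⟨hdom, _, hc, hr⟩ => isDilation_kernel hm hdom (hr.isPure hc)

theorem eventually_extBerezin_eq_berezin (hT : HasRadialProperty f m T) (hm : 1 ≤ m)
    (g : Fock n →L[ℂ] Fock n) :
    ∀ᶠ r : ℝ in 𝓝[<] 1, extBerezin f m (scale r T) g = berezin f m (scale r T) g :=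
  (hT.eventually_scale hm).mono fun _ ⟨hdom, _, hc, hr⟩ =>
    (congrFun (hr.berezin_eq_extBerezin hm hc hdom) g).symm

theorem exists_linearMap_tendsto_extBerezin (hT : HasRadialProperty f m T) (hm : 1 ≤ m) :
    ∃ Ψ : opSystem f m →ₗ[ℂ] (H →L[ℂ] H), ∀ g : opSystem f m,
      Tendsto (fun r : ℝ => extBerezin f m (scale r T) g) (𝓝[<] 1) (𝓝 (Ψ g)) :=
  exists_linearMap_tendsto (u := fun r : ℝ => extBerezinLin f m (scale r T)) fun _ hg =>
    exists_tendsto_compression (hT.eventually_isDilation_kernel hm) (tendsto_scale_one T) hg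

theorem completelyContractive_of_tendsto_extBerezin (hT : HasRadialProperty f m T) (hm : 1 ≤ m)
    {X : Submodule ℂ (Fock n →L[ℂ] Fock n)} {Ψ : X →ₗ[ℂ] (H →L[ℂ] H)}
    (hΨ : ∀ g : X, Tendsto (fun r : ℝ => extBerezin f m (scale r T) g) (𝓝[<] 1) (𝓝 (Ψ g))) :
    CompletelyContractive Ψ := by
  refine completelyContractive_of_tendsto
    (u := fun r : ℝ => (extBerezinLin f m (scale r T)).domRestrict X) ?_ hΨ
  exact (hT.eventually_isDilation_kernel hm).mono fun _ hr =>
    completelyContractive_compression _ hr.norm_map X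

theorem apply_mono_of_tendsto_extBerezin (hT : HasRadialProperty f m T) (hm : 1 ≤ m)
    (α β : List (Fin n)) {A : H →L[ℂ] H}
    (hA : Tendsto (fun r : ℝ => extBerezin f m (scale r T)
      (mono (W f m) α * star (mono (W f m) β))) (𝓝[<] 1) (𝓝 A)) :
    A = mono T α * star (mono T β) :=
  tendsto_nhds_unique hA <|
    tendsto_compression_mono (hT.eventually_isDilation_kernel hm) (tendsto_scale_one T) α β

theorem exists_algHom_of_tendsto_extBerezin (hT : HasRadialProperty f m T) (hm : 1 ≤ m)
    {v : domainAlgebra f m →ₗ[ℂ] (H →L[ℂ] H)}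
    (hv : ∀ g : domainAlgebra f m,
      Tendsto (fun r : ℝ => extBerezin f m (scale r T) g) (𝓝[<] 1) (𝓝 (v g))) :
    ∃ φ : domainAlgebra f m →ₐ[ℂ] (H →L[ℂ] H), ∀ g, φ g = v g :=
  exists_algHom_of_tendsto_compression (hT.eventually_isDilation_kernel hm) le_rfl hv

theorem tendsto_extBerezin_of_isPure (hT : HasRadialProperty f m T) (hm : 1 ≤ m)
    (hpure : IsPure f T) {g : Fock n →L[ℂ] Fock n} (hg : g ∈ opSystem f m) :
    Tendsto (fun r : ℝ => extBerezin f m (scale r T) g) (𝓝[<] 1) (𝓝 (extBerezin f m T g)) :=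
  tendsto_compression_of_isDilation (hT.eventually_isDilation_kernel hm) (tendsto_scale_one T)
    (isDilation_kernel hm hT.1 hpure) hg

end HasRadialProperty

end Radial

end NCDomain

end

open NCDomain in
theorem theorem2p7_general {n m : ℕ} (hm : 1 ≤ m)
    {H : Type*} [NormedAddCommGroup H] [InnerProductSpace ℂ H] [CompleteSpace H]
    (f : PosRegular n) (T : Fin n → H →L[ℂ] H) (hT : HasRadialProperty f m T) :
    (∀ᶠ r : ℝ in 𝓝[<] 1, BerezinDefined f m (scale r T)) ∧
    (∃ Ψ : opSystem f m →ₗ[ℂ] (H →L[ℂ] H),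
      (∀ g : opSystem f m,
        Tendsto (fun r : ℝ => berezin f m (scale r T) g) (𝓝[<] 1) (𝓝 (Ψ g))) ∧
      Ψ ⟨1, one_mem_opSystem f m⟩ = 1 ∧
      CompletelyContractive Ψ ∧
      (∀ α β : List (Fin n), Ψ ⟨mono (W f m) α * star (mono (W f m) β),
          mono_mem_opSystem f m α β⟩ = mono T α * star (mono T β)) ∧
      CompletelyContractive (Ψ ∘ₗ Submodule.inclusion (domainAlgebra_le_opSystem f m)) ∧
      (∃ φ : domainAlgebra f m →ₐ[ℂ] (H →L[ℂ] H), ∀ g : domainAlgebra f m,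
        φ g = Ψ ⟨g, domainAlgebra_le_opSystem f m g.2⟩)) ∧
    (IsPure f T →
      (∀ h : H, HasSum (fun α => kernelTerm f m T α h) (kernel f m T h)) ∧
      ∀ g ∈ opSystem f m, Tendsto (fun r : ℝ => berezin f m (scale r T) g) (𝓝[<] 1)
        (𝓝 (extBerezin f m T g))) := by
  have hberezin := hT.eventually_extBerezin_eq_berezin hm
  obtain ⟨Ψ, hΨ⟩ := hT.exists_linearMap_tendsto_extBerezin hm
  have hword (α β : List (Fin n)) : Ψ ⟨mono (W f m) α * star (mono (W f m) β),
      mono_mem_opSystem f m α β⟩ = mono T α * star (mono T β) :=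
    hT.apply_mono_of_tendsto_extBerezin hm α β (hΨ ⟨_, mono_mem_opSystem f m α β⟩)
  have hcc : CompletelyContractive Ψ :=
    hT.completelyContractive_of_tendsto_extBerezin hm (X := opSystem f m) hΨ
  refine ⟨hT.eventually_berezinDefined hm, ⟨Ψ, fun g => (hΨ g).congr' (hberezin g), ?_, hcc, hword,
    hcc.comp_inclusion _, ?_⟩, fun hpure => ⟨hasSum_kernelTerm hm hT.1 hpure, fun g hg => ?_⟩⟩
  · simpa [mono] using hword [] []
  · exact hT.exists_algHom_of_tendsto_extBerezin hm
      (v := Ψ ∘ₗ Submodule.inclusion (domainAlgebra_le_opSystem f m)) fun g =>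
        hΨ (Submodule.inclusion (domainAlgebra_le_opSystem f m) g)
  · exact (hT.tendsto_extBerezin_of_isPure hm hpure hg).congr' (hberezin g)

theorem theorem2p7 {n m : ℕ} (hn : 1 ≤ n) (hm : 1 ≤ m)
    {H : Type*} [NormedAddCommGroup H] [InnerProductSpace ℂ H] [CompleteSpace H]
    (f : NCDomain.PosRegular n) {ρ : ℝ} (hρ : 0 < ρ) (hf : f.IsFreeHolomorphicOn H ρ)
    (T : Fin n → H →L[ℂ] H) (hT : NCDomain.HasRadialProperty f m T) :
    (∀ᶠ r : ℝ in 𝓝[<] 1, NCDomain.BerezinDefined f m (NCDomain.scale r T)) ∧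
    (∃ Ψ : NCDomain.opSystem f m →ₗ[ℂ] (H →L[ℂ] H),
      (∀ g : NCDomain.opSystem f m,
        Tendsto (fun r : ℝ => NCDomain.berezin f m (NCDomain.scale r T) g) (𝓝[<] 1) (𝓝 (Ψ g))) ∧
      Ψ ⟨1, NCDomain.one_mem_opSystem f m⟩ = 1 ∧
      NCDomain.CompletelyContractive Ψ ∧
      (∀ α β : List (Fin n),
        Ψ ⟨NCDomain.mono (NCDomain.W f m) α * star (NCDomain.mono (NCDomain.W f m) β),
          NCDomain.mono_mem_opSystem f m α β⟩ = NCDomain.mono T α * star (NCDomain.mono T β)) ∧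
      NCDomain.CompletelyContractive
        (Ψ ∘ₗ Submodule.inclusion (NCDomain.domainAlgebra_le_opSystem f m)) ∧
      (∃ φ : NCDomain.domainAlgebra f m →ₐ[ℂ] (H →L[ℂ] H), ∀ g : NCDomain.domainAlgebra f m,
        φ g = Ψ ⟨g, NCDomain.domainAlgebra_le_opSystem f m g.2⟩)) ∧
    (NCDomain.IsPure f T →
      (∀ h : H, HasSum (fun α => NCDomain.kernelTerm f m T α h) (NCDomain.kernel f m T h)) ∧
      ∀ g ∈ NCDomain.opSystem f m,
        Tendsto (fun r : ℝ => NCDomain.berezin f m (NCDomain.scale r T) g) (𝓝[<] 1)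
          (𝓝 (NCDomain.extBerezin f m T g))) :=
  theorem2p7_general hm f T hT
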